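/- Consider a time-slotted load balancing system with one dispatcher and $N$ parallel servers. In slot $t=0,1,2,\dots$ the state is $Z(t)=(\mathbf Q(t),m(t))$, where $\mathbf Q(t)\in\mathbb Z_{\ge0}^N$ is the vector of queue lengths and $m(t)$ is the memory state of the dispatcher, in a finite set. A policy selects a random server $s$ with a distribution that depends only on $Z(t)$; all $A_\Sigma(t)$ exogenous arrivals of the slot join queue $s$, i.e. $A_s(t)=A_\Sigma(t)$ and $A_n(t)=0$ for $n\ne s$, and $Q_n(t+1)=\max(Q_n(t)+A_n(t)-S_n(t),0)$, where $S_n(t)$ is the service offered to queue $n$; the law of $m(t+1)$ is a function of $Z(t)$ and of what happened in slot $t$. The $A_\Sigma(t)$ are i.i.d., integer valued with $0\le A_\Sigma(t)\le A_{\max}$; for each $n$ the $S_n(t)$ are i.i.d., integer valued with $0\le S_n(t)\le S_{\max}$ and mean $\mu_n$; arrivals and services are mutually independent, and given the past and $Z(t)$ the choice of $s$ is independent of $A_\Sigma(t)$ and $(S_n(t))_n$. So $Z$ is a time-homogeneous Markov chain; let its state space $\mathcal Z$ be nonempty and closed under all transitions. Put $\mu_\Sigma=\sum_n\mu_n$ and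 consider a family of such systems $Z^{(\epsilon)}$, $0<\epsilon\le\mu_\Sigma$, with the same servers, policy, state space and bound $A_{\max}$, in which the arrivals have mean $\mu_\Sigma-\epsilon$. The system $Z^{(\epsilon)}$ is stable if, for every initial distribution on $\mathcal Z$, $\limsup_{C\to\infty}\limsup_{t\to\infty}\mathbb P(\sum_nQ_n^{(\epsilon)}(t)>C)=0$, and the policy is throughput optimal if $Z^{(\epsilon)}$ is stable for every $\epsilon\in(0,\mu_\Sigma]$. For an integer $T_1>0$ and reals $K_1\ge0$, $\gamma>0$, the drift condition $D_\epsilon(T_1,K_1,\gamma)$ says that, for every initial distribution on $\mathcal Z$, every $t_0=1,2,\dots$ and every $Z=(\mathbf Q,m)\in\mathcal Z$ with $\mathbb P(Z^{(\epsilon)}(t_0)=Z)>0$, $$\mathbb E\Big[\sum_{t=t_0}^{t_0+T_1-1}\langle\mathbf Q(t),\mathbf A(t)-\mathbf S(t)\rangle\,\Big|\,Z^{(\epsilon)}(t_0)=Z\Big]\le-\gamma\|\mathbf Q\|+K_1,$$ with the Euclidean inner product and norm. (1) If for each $\epsilon\in(0,\mu_\Sigma]$ there are $T_1>0$, $K_1\ge0$,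 $\gamma>0$ (which may depend on $\epsilon$) such that $D_\epsilon(T_1,K_1,\gamma)$ holds, then the policy is throughput optimal. (2) Let $T_1>0$, $K_1\ge0$, $\gamma>0$, and let $E\subseteq(0,\mu_\Sigma]$ be a set such that $D_\epsilon(T_1,K_1,\gamma)$ holds for all $\epsilon\in E$. Then for every $\epsilon\in E$ the chain $Z^{(\epsilon)}$ is stable, has a stationary distribution, and is positive recurrent in the following sense: every essential state (a state accessible from each state accessible from it) has finite mean return time, and from every state the chain almost surely reaches an essential state; in particular all states are positive recurrent if the chain is irreducible. Moreover, there are finite constants $M_r$, $r\in\mathbb N$, that do not depend on $\epsilon$, such that for all $\epsilon\in E$, all $r\in\mathbb N$, and every stationary distribution of $Z^{(\epsilon)}$, the stationary queue-length vector satisfies $\mathbb E\big[\|\overline{\mathbf Q}^{(\epsilon)}\|^r\big]\le M_r$. -/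

import Mathlib

open MeasureTheory ProbabilityTheory Set Filter Topology
open scoped ENNReal

/-- A state `Z = (Q, m)` of the load balancing system: the vector of the `N` queue lengths and
the memory state of the dispatcher. -/
abbrev LBState (N : ℕ) (M : Type*) : Type _ := (Fin N → ℕ) × M

/-- What happens in one time slot: the server `s` selected by the dispatcher, the number `a` of
exogenous arrivals, and the vector `v` of offered services. -/
abbrev LBSlot (N : ℕ) : Type := Fin N × ℕ × (Fin N → ℕ)

namespace LBSlot

variable {N : ℕ}

/-- Arrivals to each queue: all exogenous arrivals join the selected queue. -/
def arrivals (w : LBSlot N) (n : Fin N) : ℕ := if n = w.1 then w.2.1 else 0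

/-- Offered service of each server. -/
def services (w : LBSlot N) (n : Fin N) : ℕ := w.2.2 n

/-- The vector `A - S` of arrivals minus offered services. -/
noncomputable def netInput (w : LBSlot N) : EuclideanSpace ℝ (Fin N) :=
  WithLp.toLp 2 fun n => (w.arrivals n : ℝ) - (w.services n : ℝ)

/-- The queue dynamics `Q_n(t+1) = [Q_n(t) + A_n(t) - S_n(t)]⁺`; subtraction in `ℕ` is truncated
at `0`, which is exactly the positive part. -/
def nextQueue (q : Fin N → ℕ) (w : LBSlot N) (n : Fin N) : ℕ :=
  q n + w.arrivals n - w.services n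

end LBSlot

/-- The vector of queue lengths of a state, in `ℝ^N` with the Euclidean norm. -/
noncomputable def LBState.queue {N : ℕ} {M : Type*} (z : LBState N M) :
    EuclideanSpace ℝ (Fin N) :=
  WithLp.toLp 2 fun n => (z.1 n : ℝ)

/-- A family of load balancing systems with `N` servers and memory states in `M`, indexed by
the distance `ε` of the arrival rate to the capacity boundary. The service laws and the policy
(dispatching distribution and memory update) do not depend on `ε`. -/
structure LoadBalancing (N : ℕ) (M : Type*) where
  /-- law of the offered service of each server in one slot -/
  service : Fin N → PMF ℕ
  /-- uniform bound on the offered services -/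
  Smax : ℕ
  service_le : ∀ n, ∀ k ∈ (service n).support, k ≤ Smax
  /-- law of the number of exogenous arrivals in one slot of the `ε`-th system -/
  arrival : ℝ → PMF ℕ
  /-- uniform bound on the arrivals -/
  Amax : ℕ
  arrival_le : ∀ ε ∈ Ioc 0 (∑ n, ∫ k, (k : ℝ) ∂(service n).toMeasure),
    ∀ k ∈ (arrival ε).support, k ≤ Amax
  /-- the arrival rate of the `ε`-th system is `μ_Σ - ε` -/
  arrival_mean : ∀ ε ∈ Ioc 0 (∑ n, ∫ k, (k : ℝ) ∂(service n).toMeasure),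
    ∫ k, (k : ℝ) ∂(arrival ε).toMeasure = (∑ n, ∫ k, (k : ℝ) ∂(service n).toMeasure) - ε
  /-- the dispatching distribution, a function of the state at the beginning of the slot -/
  dispatch : LBState N M → PMF (Fin N)
  /-- law of the new memory state, given the state at the beginning of the slot and everything
  that happened in the slot -/
  memory : LBState N M → LBSlot N → PMF M
  /-- the state space of the Markov chains -/
  space : Set (LBState N M)
  space_nonempty : space.Nonempty
  /-- no transition leaves the state space -/
  space_closed : ∀ ε ∈ Ioc 0 (∑ n, ∫ k, (k : ℝ) ∂(service n).toMeasure),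
    ∀ z ∈ space, ∀ s ∈ (dispatch z).support, ∀ a ∈ (arrival ε).support, ∀ v : Fin N → ℕ,
      (∀ n, v n ∈ (service n).support) → ∀ m ∈ (memory z (s, a, v)).support,
        (LBSlot.nextQueue z.1 (s, a, v), m) ∈ space

namespace LoadBalancing

noncomputable section

variable {N : ℕ} {M : Type*}

/-- The total service rate `μ_Σ = ∑ μ_n`. -/
def muSum (L : LoadBalancing N M) : ℝ := ∑ n, ∫ k, (k : ℝ) ∂(L.service n).toMeasure

/-- Joint law of the offered services of one slot: independent over the servers. -/
def serviceLaw (L : LoadBalancing N M) : PMF (Fin N → ℕ) :=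
  (Measure.pi fun n => (L.service n).toMeasure).toPMF

/-- Law of one slot, given the state `z` at its beginning: dispatching decision, exogenous
arrivals and offered services are independent. -/
def slotLaw (L : LoadBalancing N M) (ε : ℝ) (z : LBState N M) : PMF (LBSlot N) :=
  (L.dispatch z).bind fun s => (L.arrival ε).bind fun a => L.serviceLaw.map fun v => (s, a, v)

/-- Law of the next state, given the present state and the present slot. -/
def next (L : LoadBalancing N M) (z : LBState N M) (w : LBSlot N) : PMF (LBState N M) :=
  (L.memory z w).map fun m => (LBSlot.nextQueue z.1 w, m)

/-- One-step transition law of the Markov chain `Z(t) = (Q(t), m(t))`. -/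
def step (L : LoadBalancing N M) (ε : ℝ) (z : LBState N M) : PMF (LBState N M) :=
  (L.slotLaw ε z).bind (L.next z)

/-- Law of a state together with its slot, when the state has law `p`. -/
def withSlot (L : LoadBalancing N M) (ε : ℝ) (p : PMF (LBState N M)) :
    PMF (LBState N M × LBSlot N) :=
  p.bind fun z => (L.slotLaw ε z).map fun w => (z, w)

variable [Finite M] [MeasurableSpace M] [MeasurableSingletonClass M]

/-- Transition kernel of the pair (state, slot). -/
def pairKernel (L : LoadBalancing N M) (ε : ℝ) :
    Kernel (LBState N M × LBSlot N) (LBState N M × LBSlot N) :=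
  Kernel.ofFunOfCountable fun y => (L.withSlot ε (L.next y.1 y.2)).toMeasure

instance (L : LoadBalancing N M) (ε : ℝ) : IsMarkovKernel (L.pairKernel ε) :=
  ⟨fun y => by
    change IsProbabilityMeasure (L.withSlot ε (L.next y.1 y.2)).toMeasure
    infer_instance⟩

/-- Law of the whole trajectory `(Z(t), slot t)`, `t = 0, 1, 2, …`, of the `ε`-th system when
`Z(0)` has law `init`. -/
def pathLaw (L : LoadBalancing N M) (ε : ℝ) (init : PMF (LBState N M)) :
    Measure (ℕ → LBState N M × LBSlot N) :=
  Kernel.trajMeasure (X := fun _ => LBState N M × LBSlot N) (L.withSlot ε init).toMeasure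
    fun t => (L.pairKernel ε).comap
      (fun (x : (i : Finset.Iic t) → LBState N M × LBSlot N) =>
        x ⟨t, Finset.mem_Iic.2 le_rfl⟩) (measurable_pi_apply _)

/-- The drift condition for the `ε`-th system: for every initial law, every `t₀ = 1, 2, …` and
every state `z` that `Z(t₀)` takes with positive probability,
`E[∑_{t=t₀}^{t₀+T₁-1} ⟨Q(t), A(t) - S(t)⟩ | Z(t₀) = z] ≤ -γ ‖Q‖ + K₁`. -/
def DriftCondition (L : LoadBalancing N M) (ε : ℝ) (T₁ : ℕ) (K₁ γ : ℝ) : Prop :=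
  ∀ init : PMF (LBState N M), init.support ⊆ L.space → ∀ t₀ : ℕ, 1 ≤ t₀ → ∀ z ∈ L.space,
    L.pathLaw ε init {ω | (ω t₀).1 = z} ≠ 0 →
      ∫ ω, ∑ t ∈ Finset.Ico t₀ (t₀ + T₁), inner ℝ (ω t).1.queue (ω t).2.netInput
        ∂(ProbabilityTheory.cond (L.pathLaw ε init) {ω | (ω t₀).1 = z}) ≤ -γ * ‖z.queue‖ + K₁

/-- Stability of the `ε`-th system, for every initial law on the state space:
`limsup_{C → ∞} limsup_{t → ∞} P(∑ Q_n(t) > C) = 0`. -/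
def Stable (L : LoadBalancing N M) (ε : ℝ) : Prop :=
  ∀ init : PMF (LBState N M), init.support ⊆ L.space →
    limsup (fun C : ℝ => limsup (fun t : ℕ =>
      L.pathLaw ε init {ω | C < ∑ n, ((ω t).1.1 n : ℝ)}) atTop) atTop = 0

/-- The policy stabilizes the system for every arrival rate `μ_Σ - ε` in the capacity region. -/
def ThroughputOptimal (L : LoadBalancing N M) : Prop :=
  ∀ ε ∈ Ioc 0 L.muSum, L.Stable ε

/-- `z'` is reached from `z` with positive probability. -/
def Accessible (L : LoadBalancing N M) (ε : ℝ) (z z' : LBState N M) : Prop :=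
  ∃ t : ℕ, L.pathLaw ε (PMF.pure z) {ω | (ω t).1 = z'} ≠ 0

/-- A state is essential if it is accessible from each state accessible from it. In an
irreducible chain every state is essential. -/
def Essential (L : LoadBalancing N M) (ε : ℝ) (z : LBState N M) : Prop :=
  ∀ z', L.Accessible ε z z' → L.Accessible ε z' z

/-- First time `t ≥ 1` at which the trajectory is in state `z` (`∞` if there is none). -/
def returnTime (z : LBState N M) (ω : ℕ → LBState N M × LBSlot N) : ℝ≥0∞ :=
  ⨅ (t : ℕ) (_ : 1 ≤ t) (_ : (ω t).1 = z), (t : ℝ≥0∞)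

/-- A state is positive recurrent if its mean return time is finite. -/
def PositiveRecurrentState (L : LoadBalancing N M) (ε : ℝ) (z : LBState N M) : Prop :=
  ∫⁻ ω, returnTime z ω ∂(L.pathLaw ε (PMF.pure z)) < ∞

/-- Positive recurrence of the chain: every essential state is positive recurrent, and from
every state the chain almost surely reaches an essential state. If the chain is irreducible on
its state space, this says that all states are positive recurrent. -/
def PositiveRecurrent (L : LoadBalancing N M) (ε : ℝ) : Prop :=
  (∀ z ∈ L.space, L.Essential ε z → L.PositiveRecurrentState ε z) ∧
    ∀ z ∈ L.space, ∀ᵐ ω ∂(L.pathLaw ε (PMF.pure z)), ∃ t : ℕ, L.Essential ε (ω t).1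

/-- `p` is a stationary distribution of the chain `Z` of the `ε`-th system. -/
def IsStationary (L : LoadBalancing N M) (ε : ℝ) (p : PMF (LBState N M)) : Prop :=
  p.support ⊆ L.space ∧ p.bind (L.step ε) = p

end

end LoadBalancing

/-! Everything rests on one estimate: for a small θ > 0, the expectation of exp(θ‖Q(t)‖) is
eventually at most a constant B that depends neither on the starting state nor on ε, only on the
drift constants and the increment bound.

To get it, note that the positive part can only shrink squares, so over T₁ slots ‖Q‖² grows by at
most twice the sum in the drift condition plus a constant. Dividing by 2‖Q‖ turns the hypothesis
into a mean decrease of ‖Q‖ of nearly γ when ‖Q‖ is large. The increments of ‖Q‖ are bounded, so exp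
x ≤ 1 + x + x² for |x| ≤ 1 upgrades this to a geometric drift of the exponential
(`exp_mul_le_of_sq_le`, `LoadBalancing.lintegral_expNorm_le_of_drift`). Iterating it gives B
(`PMF.eventually_lintegral_iterate_le`).

The rest is general theory of a countable chain with a function W that has finite sublevel sets and
eventually bounded expectation. Markov's inequality gives stability. Limits of time averages are
stationary (`PMF.exists_stationary`). Under a stationary law the truncations of W have a constant
expectation, so B bounds the integral of W (`PMF.lintegral_le_of_stationary`) and hence all moments.
A stationary law charging an essential state makes its mean return time finite by Kac's formula
(`PMF.IsEssential.tsum_avoid_lt_top`). The chain visits a finite set often enough that it cannot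
avoid the essential states forever (`PMF.iInf_avoid_isEssential_eq_zero`). The Markov property of
the path law carries these facts over to trajectories. -/

namespace PMF

/-- Both sides have total mass one, so no inequality can be strict. Thus invariance of a law need
only be checked as an inequality. -/
theorem eq_of_le {S : Type*} {p q : PMF S} (h : ∀ z, p z ≤ q z) : p = q := by
  ext z
  refine (h z).antisymm (not_lt.1 fun hlt => ?_)
  have := ENNReal.tsum_lt_tsum (by rw [p.tsum_coe]; exact ENNReal.one_ne_top) h hlt
  simp [tsum_coe] at this

/-! ### Integration against discrete laws. -/

section Integral

variable {S S' : Type*} [MeasurableSpace S] [MeasurableSingletonClass S]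

theorem lintegral_toMeasure_pure (z : S) (f : S → ℝ≥0∞) :
    ∫⁻ x, f x ∂(PMF.pure z).toMeasure = f z := by
  rw [toMeasure_pure, lintegral_dirac]

theorem apply_eq_toMeasure_singleton (p : PMF S) (z : S) : p z = p.toMeasure {z} :=
  (p.toMeasure_apply_singleton z (measurableSet_singleton z)).symm

variable [Countable S] [Countable S'] [MeasurableSpace S'] [MeasurableSingletonClass S']

theorem lintegral_toMeasure (p : PMF S) (f : S → ℝ≥0∞) :
    ∫⁻ z, f z ∂p.toMeasure = ∑' z, p z * f z := by
  rw [lintegral_countable']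
  exact tsum_congr fun z => by
    rw [p.toMeasure_apply_singleton z (measurableSet_singleton z), mul_comm]

theorem lintegral_toMeasure_bind (p : PMF S) (q : S → PMF S') (f : S' → ℝ≥0∞) :
    ∫⁻ x, f x ∂(p.bind q).toMeasure = ∫⁻ z, ∫⁻ x, f x ∂(q z).toMeasure ∂p.toMeasure := by
  simp only [lintegral_toMeasure, bind_apply, ← ENNReal.tsum_mul_left, ← ENNReal.tsum_mul_right]
  rw [ENNReal.tsum_comm]
  simp only [mul_assoc]

theorem lintegral_toMeasure_map (p : PMF S) (g : S → S') (f : S' → ℝ≥0∞) :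
    ∫⁻ x, f x ∂(p.map g).toMeasure = ∫⁻ z, f (g z) ∂p.toMeasure := by
  rw [PMF.map, lintegral_toMeasure_bind]
  exact lintegral_congr fun z => lintegral_toMeasure_pure _ _

theorem lintegral_mono_support (p : PMF S) {f g : S → ℝ≥0∞} (h : ∀ z ∈ p.support, f z ≤ g z) :
    ∫⁻ z, f z ∂p.toMeasure ≤ ∫⁻ z, g z ∂p.toMeasure := by
  simp only [lintegral_toMeasure]
  refine ENNReal.tsum_le_tsum fun z => ?_
  by_cases hz : p z = 0
  · simp [hz]
  · exact mul_le_mul_right (h z hz) _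

theorem measure_ge_le_div (p : PMF S) {W : S → ℝ≥0∞} {B c : ℝ≥0∞}
    (h : ∫⁻ x, W x ∂p.toMeasure ≤ B) (hc : c ≠ 0) (hc' : c ≠ ∞) :
    p.toMeasure {x | c ≤ W x} ≤ B / c :=
  (meas_ge_le_lintegral_div (Measurable.of_discrete).aemeasurable hc hc').trans
    (ENNReal.div_le_div_right h c)

end Integral

/-! ### Iterated transitions, accessibility and essential states. -/

section Iterate

variable {S : Type*} (κ : S → PMF S)

/-- The law after `t` steps of the Markov chain with transition laws `κ` started at a point. -/
noncomputable def iterate : ℕ → S → PMF S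
  | 0, z => PMF.pure z
  | t + 1, z => (iterate t z).bind κ

theorem iterate_zero (z : S) : iterate κ 0 z = PMF.pure z := rfl

theorem iterate_succ (t : ℕ) (z : S) : iterate κ (t + 1) z = (iterate κ t z).bind κ := rfl

theorem iterate_add (s t : ℕ) (z : S) :
    iterate κ (s + t) z = (iterate κ s z).bind (iterate κ t) := by
  induction t with
  | zero => exact (bind_pure _).symm
  | succ t ih => rw [← add_assoc, iterate_succ, ih, bind_bind]; rfl

theorem iterate_one (z : S) : iterate κ 1 z = κ z := by
  rw [iterate_succ, iterate_zero, pure_bind]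

theorem iterate_succ' (t : ℕ) (z : S) : iterate κ (t + 1) z = (κ z).bind (iterate κ t) := by
  rw [add_comm, iterate_add, iterate_one]

theorem bind_iterate {p : PMF S} (hp : p.bind κ = p) (t : ℕ) : p.bind (iterate κ t) = p := by
  induction t with
  | zero => exact bind_pure p
  | succ t ih =>
    have : p.bind (iterate κ (t + 1)) = (p.bind (iterate κ t)).bind κ := by
      rw [bind_bind]; rfl
    rw [this, ih, hp]

/-- `z'` is reached from `z` with positive probability. -/
def Reaches (z z' : S) : Prop := ∃ t, z' ∈ (iterate κ t z).support

variable {κ}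

theorem Reaches.refl (z : S) : Reaches κ z z := ⟨0, by simp [iterate_zero]⟩

theorem Reaches.trans {x y z : S} (h : Reaches κ x y) (h' : Reaches κ y z) : Reaches κ x z := by
  obtain ⟨s, hs⟩ := h
  obtain ⟨t, ht⟩ := h'
  exact ⟨s + t, by rw [iterate_add, mem_support_bind_iff]; exact ⟨y, hs, ht⟩⟩

theorem Reaches.of_mem_support {z z' : S} (h : z' ∈ (κ z).support) : Reaches κ z z' :=
  ⟨1, by rwa [iterate_one]⟩

theorem support_iterate_subset {X : Set S} (hX : ∀ z ∈ X, (κ z).support ⊆ X) {z : S}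
    (hz : z ∈ X) (t : ℕ) : (iterate κ t z).support ⊆ X := by
  induction t with
  | zero => simpa [iterate_zero] using hz
  | succ t ih =>
    intro y hy
    rw [iterate_succ, mem_support_bind_iff] at hy
    obtain ⟨x, hx, hy⟩ := hy
    exact hX x (ih hx) hy

variable (κ)

/-- A state is essential if it is reached from every state that it reaches. -/
def IsEssential (z : S) : Prop := ∀ z', Reaches κ z z' → Reaches κ z' z

variable {κ}

theorem IsEssential.of_reaches {z z' : S} (h : IsEssential κ z) (h' : Reaches κ z z') :
    IsEssential κ z' :=
  fun _ hy => (h _ (h'.trans hy)).trans h'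

/-- If a finite set is reached from everywhere in `X`, then so are the essential states. -/
theorem exists_reaches_isEssential {X F : Set S} (hX : ∀ z ∈ X, (κ z).support ⊆ X)
    (hF : F.Finite) (h : ∀ z ∈ X, ∃ y ∈ F, Reaches κ z y) {z : S} (hz : z ∈ X) :
    ∃ y, Reaches κ z y ∧ IsEssential κ y := by
  have hreach {x y : S} (hx : x ∈ X) (hxy : Reaches κ x y) : y ∈ X := by
    obtain ⟨t, ht⟩ := hxy
    exact support_iterate_subset hX hx t ht
  have hfin (x : S) : {y ∈ F | Reaches κ x y}.Finite := hF.subset fun _ hy => hy.1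
  -- Among the states of F reached from z, take one that reaches the fewest states of F. Whatever it
  -- reaches leads back to F, and by minimality no state of F, in particular y itself, has been lost
  -- on the way.
  obtain ⟨y, ⟨hyF, hzy⟩, hmin⟩ := Set.exists_min_image {y ∈ F | Reaches κ z y}
    (fun x => {y ∈ F | Reaches κ x y}.ncard) (hfin z) (h z hz)
  refine ⟨y, hzy, fun x hyx => ?_⟩
  obtain ⟨w, hwF, hxw⟩ := h x (hreach (hreach hz hzy) hyx)
  have hsub : {u ∈ F | Reaches κ w u} ⊆ {u ∈ F | Reaches κ y u} :=
    fun u hu => ⟨hu.1, (hyx.trans hxw).trans hu.2⟩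
  have heq := Set.eq_of_subset_of_ncard_le hsub (hmin w ⟨hwF, (hzy.trans hyx).trans hxw⟩) (hfin y)
  have : y ∈ {u ∈ F | Reaches κ w u} := heq ▸ ⟨hyF, Reaches.refl y⟩
  exact hxw.trans this.2

end Iterate

/-! ### Consequences of a bound on the expectation of W at late times. -/

section Chain

variable {S : Type*} [Countable S] [MeasurableSpace S] [MeasurableSingletonClass S]
  {κ : S → PMF S} {X : Set S} {W : S → ℝ≥0∞} {B : ℝ≥0∞}

/-- The time after which the bound holds depends on the starting state, and the integral of W might
a priori be infinite. Truncating W at c cures both: the truncated integral is constant in time by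
stationarity, the reverse Fatou lemma applies, and monotone convergence removes c. -/
theorem lintegral_le_of_stationary {p : PMF S} (hp : p.bind κ = p) (hpX : p.support ⊆ X)
    (h : ∀ z ∈ X, ∀ᶠ t in atTop, ∫⁻ x, W x ∂(iterate κ t z).toMeasure ≤ B) :
    ∫⁻ x, W x ∂p.toMeasure ≤ B := by
  have htrunc (c : ℕ) : ∫⁻ x, min (W x) c ∂p.toMeasure ≤ B := by
    have hconst (t : ℕ) : ∫⁻ z, ∫⁻ x, min (W x) c ∂(iterate κ t z).toMeasure ∂p.toMeasure
        = ∫⁻ x, min (W x) c ∂p.toMeasure := by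
      rw [← lintegral_toMeasure_bind, bind_iterate κ hp]
    calc ∫⁻ x, min (W x) c ∂p.toMeasure
        = limsup (fun t : ℕ =>
            ∫⁻ z, ∫⁻ x, min (W x) c ∂(iterate κ t z).toMeasure ∂p.toMeasure) atTop := by
          simp only [hconst, limsup_const]
      _ ≤ ∫⁻ z, limsup (fun t : ℕ => ∫⁻ x, min (W x) c ∂(iterate κ t z).toMeasure) atTop
            ∂p.toMeasure := by
          refine limsup_lintegral_le (fun _ => (c : ℝ≥0∞)) (fun _ => Measurable.of_discrete)
            (fun t => ae_of_all _ fun z => ?_) (by simp)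
          calc ∫⁻ x, min (W x) c ∂(iterate κ t z).toMeasure
              ≤ ∫⁻ _, (c : ℝ≥0∞) ∂(iterate κ t z).toMeasure :=
                lintegral_mono fun _ => min_le_right _ _
            _ = c := by simp
      _ ≤ ∫⁻ _, B ∂p.toMeasure := by
          refine lintegral_mono_support p fun z hz => ?_
          refine limsup_le_of_le (by isBoundedDefault) ?_
          filter_upwards [h z (hpX hz)] with t ht
          exact (lintegral_mono fun _ => min_le_left _ _).trans ht
      _ = B := by simp
  have hsup (x : S) : W x = ⨆ c : ℕ, min (W x) (c : ℝ≥0∞) := by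
    rw [← inf_iSup_eq, ENNReal.iSup_natCast, inf_top_eq]
  calc ∫⁻ x, W x ∂p.toMeasure = ∫⁻ x, ⨆ c : ℕ, min (W x) (c : ℝ≥0∞) ∂p.toMeasure :=
        lintegral_congr hsup
    _ = ⨆ c : ℕ, ∫⁻ x, min (W x) (c : ℝ≥0∞) ∂p.toMeasure :=
        lintegral_iSup (fun _ => Measurable.of_discrete) fun a b hab x =>
          min_le_min_left _ (by exact_mod_cast hab)
    _ ≤ B := iSup_le htrunc

/-- The initial law need not integrate W. Markov's inequality is therefore used from each starting
state separately, and the reverse Fatou lemma averages over them. -/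
theorem limsup_measure_ge_le (h : ∀ z ∈ X, ∀ᶠ t in atTop, ∫⁻ x, W x ∂(iterate κ t z).toMeasure ≤ B)
    {p : PMF S} (hpX : p.support ⊆ X) {c : ℝ≥0∞} (hc : c ≠ 0) (hc' : c ≠ ∞) :
    limsup (fun t : ℕ => (p.bind (iterate κ t)).toMeasure {x | c ≤ W x}) atTop ≤ B / c := by
  have hbind (t : ℕ) : (p.bind (iterate κ t)).toMeasure {x | c ≤ W x}
      = ∫⁻ z, (iterate κ t z).toMeasure {x | c ≤ W x} ∂p.toMeasure := by
    simp only [← lintegral_indicator_one (MeasurableSet.of_discrete (s := {x | c ≤ W x}))]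
    exact lintegral_toMeasure_bind _ _ _
  simp only [hbind]
  calc _ ≤ ∫⁻ z, limsup (fun t : ℕ => (iterate κ t z).toMeasure {x | c ≤ W x}) atTop
            ∂p.toMeasure :=
        limsup_lintegral_le (fun _ => 1) (fun _ => Measurable.of_discrete)
          (fun t => ae_of_all _ fun z => prob_le_one) (by simp)
    _ ≤ ∫⁻ _, B / c ∂p.toMeasure := by
        refine lintegral_mono_support p fun z hz => limsup_le_of_le (by isBoundedDefault) ?_
        filter_upwards [h z (hpX hz)] with t ht
        exact measure_ge_le_div _ ht hc hc'
    _ = B / c := by simp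

end Chain

end PMF

namespace PMF

/-! ### Existence of a stationary law, by the Krylov–Bogoliubov method. -/

section Stationary

variable {S : Type*} [Countable S] [MeasurableSpace S] [MeasurableSingletonClass S]
  {κ : S → PMF S} {W : S → ℝ≥0∞} {B : ℝ≥0∞}

/-- A Markov chain whose laws are tight, as witnessed by a Lyapunov function with bounded
expectation, has a stationary distribution on the states that it reaches. -/
theorem exists_stationary (hW : ∀ c : ℝ≥0∞, c ≠ ∞ → {x | W x ≤ c}.Finite) (hB : B ≠ ∞) {z : S}
    (h : ∀ᶠ t in atTop, ∫⁻ x, W x ∂(iterate κ t z).toMeasure ≤ B) :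
    ∃ p : PMF S, p.bind κ = p ∧ ∀ y ∈ p.support, Reaches κ z y := by
  obtain ⟨t₀, ht₀⟩ := eventually_atTop.1 h
  -- Time averages of the laws, started at t₀ so that every term obeys the bound B.
  let ν (n : ℕ) (y : S) : ℝ≥0∞ :=
    ((n + 1 : ℕ) : ℝ≥0∞)⁻¹ * ∑ i ∈ Finset.range (n + 1), iterate κ (t₀ + i) z y
  have hn0 (n : ℕ) : ((n + 1 : ℕ) : ℝ≥0∞) ≠ 0 := by exact_mod_cast n.succ_ne_zero
  have hmean (n : ℕ) (a : ℝ≥0∞) :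
      ((n + 1 : ℕ) : ℝ≥0∞)⁻¹ * ∑ _i ∈ Finset.range (n + 1), a = a := by
    rw [Finset.sum_const, Finset.card_range, nsmul_eq_mul, ← mul_assoc,
      ENNReal.inv_mul_cancel (hn0 n) (ENNReal.natCast_ne_top _), one_mul]
  have hνsum (n : ℕ) (F : Finset S) : ∑ y ∈ F, ν n y =
      ((n + 1 : ℕ) : ℝ≥0∞)⁻¹ *
        ∑ i ∈ Finset.range (n + 1), ∑ y ∈ F, iterate κ (t₀ + i) z y := by
    rw [Finset.sum_comm, Finset.mul_sum]
  have hνle (n : ℕ) (F : Finset S) : ∑ y ∈ F, ν n y ≤ 1 := by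
    rw [hνsum, ← hmean n 1]
    refine mul_le_mul_right (Finset.sum_le_sum fun i _ => ?_) _
    exact (ENNReal.sum_le_tsum F).trans_eq (tsum_coe _)
  -- Tightness: outside a finite sublevel set the averages have mass at most B / c, so no mass
  -- escapes in the limit.
  have hνge (n : ℕ) {c : ℝ≥0∞} (hc : c ≠ 0) (hc' : c ≠ ∞) :
      1 ≤ ∑ y ∈ (hW c hc').toFinset, ν n y + B / c := by
    conv_rhs => rw [hνsum, ← hmean n (B / c), ← mul_add, ← Finset.sum_add_distrib]
    conv_lhs => rw [← hmean n 1]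
    refine mul_le_mul_right (Finset.sum_le_sum fun i _ => ?_) _
    rw [← toMeasure_apply_finset, Set.Finite.coe_toFinset,
      ← measure_univ (μ := (iterate κ (t₀ + i) z).toMeasure)]
    calc _ ≤ (iterate κ (t₀ + i) z).toMeasure ({x | W x ≤ c} ∪ {x | c ≤ W x}) :=
          measure_mono fun x _ => le_total (W x) c
      _ ≤ _ := (measure_union_le _ _).trans
          (add_le_add_right (measure_ge_le_div _ (ht₀ _ (Nat.le_add_right _ _)) hc hc') _)
  -- Shifting the averaging window by one costs a single term. Only finite sums are used, as these
  -- survive a pointwise limit.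
  have hνκ (n : ℕ) (F : Finset S) (x : S) :
      ∑ y ∈ F, ν n y * κ y x ≤ ν n x + ((n + 1 : ℕ) : ℝ≥0∞)⁻¹ := by
    have hstep (i : ℕ) : ∑ y ∈ F, iterate κ (t₀ + i) z y * κ y x
        ≤ iterate κ (t₀ + (i + 1)) z x := by
      rw [← add_assoc, iterate_succ, bind_apply]
      exact ENNReal.sum_le_tsum F
    calc ∑ y ∈ F, ν n y * κ y x
        = ((n + 1 : ℕ) : ℝ≥0∞)⁻¹ * ∑ i ∈ Finset.range (n + 1),
            ∑ y ∈ F, iterate κ (t₀ + i) z y * κ y x := by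
          rw [Finset.sum_comm, Finset.mul_sum]
          exact Finset.sum_congr rfl fun y _ => by rw [mul_assoc, Finset.sum_mul]
      _ ≤ ((n + 1 : ℕ) : ℝ≥0∞)⁻¹ *
            ∑ i ∈ Finset.range (n + 1), iterate κ (t₀ + (i + 1)) z x :=
          mul_le_mul_right (Finset.sum_le_sum fun i _ => hstep i) _
      _ ≤ ((n + 1 : ℕ) : ℝ≥0∞)⁻¹ *
            (∑ i ∈ Finset.range (n + 1), iterate κ (t₀ + i) z x + 1) := by
          refine mul_le_mul_right ?_ _
          calc _ ≤ ∑ i ∈ Finset.range (n + 1), iterate κ (t₀ + (i + 1)) z x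
                  + iterate κ (t₀ + 0) z x := le_self_add
            _ ≤ _ := by
              rw [← Finset.sum_range_succ' (fun i => iterate κ (t₀ + i) z x),
                Finset.sum_range_succ]
              exact add_le_add_right (coe_le_one _ _) _
      _ = _ := by rw [mul_add, mul_one]
  -- An ultrafilter gives all pointwise limits at once by compactness of `ℝ≥0∞`, with no diagonal
  -- subsequence.
  have hlim (y : S) : ∃ a, Tendsto (fun n => ν n y) (hyperfilter ℕ) (𝓝 a) :=
    ⟨_, ((hyperfilter ℕ).map fun n => ν n y).le_nhds_lim⟩
  choose q hq using hlim
  have hqF (F : Finset S) :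
      Tendsto (fun n => ∑ y ∈ F, ν n y) (hyperfilter ℕ) (𝓝 (∑ y ∈ F, q y)) :=
    tendsto_finsetSum F fun y _ => hq y
  have hq1 : ∑' y, q y = 1 := by
    refine le_antisymm ?_ ?_
    · rw [ENNReal.tsum_eq_iSup_sum]
      exact iSup_le fun F => le_of_tendsto' (hqF F) fun n => hνle n F
    · have hc (c : ℕ) : 1 ≤ ∑' y, q y + B / ((c + 1 : ℕ) : ℝ≥0∞) := by
        have h1 : 1 ≤ ∑ y ∈ (hW _ (ENNReal.natCast_ne_top (c + 1))).toFinset, q y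
            + B / ((c + 1 : ℕ) : ℝ≥0∞) :=
          ge_of_tendsto' ((hqF _).add_const _) fun n =>
            hνge n (hn0 c) (ENNReal.natCast_ne_top _)
        exact h1.trans (add_le_add_left (ENNReal.sum_le_tsum _) _)
      have hlim : Tendsto (fun c : ℕ => ∑' y, q y + B / ((c + 1 : ℕ) : ℝ≥0∞)) atTop
          (𝓝 (∑' y, q y + 0)) := by
        refine tendsto_const_nhds.add ?_
        have := ENNReal.Tendsto.const_div (a := B)
          (ENNReal.tendsto_nat_nhds_top.comp (tendsto_add_atTop_nat 1)) (Or.inr hB)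
        simpa using this
      simpa using ge_of_tendsto' hlim hc
  have hinv : Tendsto (fun n : ℕ => ((n + 1 : ℕ) : ℝ≥0∞)⁻¹) (hyperfilter ℕ) (𝓝 0) :=
    (ENNReal.tendsto_inv_nat_nhds_zero.comp (tendsto_add_atTop_nat 1)).mono_left
      Nat.hyperfilter_le_atTop
  let p : PMF S := ⟨q, hq1 ▸ ENNReal.summable.hasSum⟩
  refine ⟨p, eq_of_le fun x => ?_, fun y hy => ?_⟩
  · rw [bind_apply, ENNReal.tsum_eq_iSup_sum]
    refine iSup_le fun F => ?_
    have hl : Tendsto (fun n => ∑ y ∈ F, ν n y * κ y x) (hyperfilter ℕ)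
        (𝓝 (∑ y ∈ F, p y * κ y x)) :=
      tendsto_finsetSum F fun y _ =>
        ENNReal.Tendsto.mul_const (hq y) (Or.inr (apply_ne_top _ _))
    have hr := (hq x).add hinv
    rw [add_zero] at hr
    exact le_of_tendsto_of_tendsto' hl hr fun n => hνκ n F x
  · by_contra hzy
    refine hy (tendsto_nhds_unique (hq y) ?_)
    have h0 (n : ℕ) : ν n y = 0 := by
      refine mul_eq_zero_of_right _ (Finset.sum_eq_zero fun i _ => ?_)
      by_contra hne
      exact hzy ⟨_, hne⟩
    simp only [h0]
    exact tendsto_const_nhds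

end Stationary

/-! ### Avoidance probabilities and Kac's formula. -/

section Avoid

variable {S : Type*} [MeasurableSpace S] (κ : S → PMF S) (A : Set S)

/-- The probability that the Markov chain started at a point is outside `A` at the times
`1, …, n`. -/
noncomputable def avoid : ℕ → S → ℝ≥0∞
  | 0, _ => 1
  | n + 1, z => ∫⁻ x, Aᶜ.indicator (avoid n) x ∂(κ z).toMeasure

theorem avoid_succ (n : ℕ) (z : S) :
    avoid κ A (n + 1) z = ∫⁻ x, Aᶜ.indicator (avoid κ A n) x ∂(κ z).toMeasure := rfl

theorem avoid_le_one (n : ℕ) (z : S) : avoid κ A n z ≤ 1 := by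
  induction n generalizing z with
  | zero => exact le_rfl
  | succ n ih =>
    calc avoid κ A (n + 1) z ≤ ∫⁻ _, 1 ∂(κ z).toMeasure :=
          lintegral_mono fun x => (Set.indicator_le_self _ _ x).trans (ih x)
      _ = 1 := by simp

theorem antitone_avoid (z : S) : Antitone fun n => avoid κ A n z := by
  refine antitone_nat_of_succ_le fun n => ?_
  induction n generalizing z with
  | zero => exact avoid_le_one κ A 1 z
  | succ n ih => exact lintegral_mono fun x => Set.indicator_le_indicator (ih x)

variable [Countable S] [MeasurableSingletonClass S]

variable {κ} in
/-- Kac's formula, as an inequality. -/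
theorem tsum_avoid_singleton_le {p : PMF S} (hp : p.bind κ = p) (z : S) :
    p z * ∑' n, avoid κ {z} n z ≤ 1 := by
  -- After one stationary step, avoiding z at times 1, …, n + 1 means starting outside z and
  -- avoiding it n more times. The missing contribution is that of the start at z, and these
  -- contributions telescope.
  have hsplit (n : ℕ) : ∫⁻ x, avoid κ {z} n x ∂p.toMeasure
      = ∫⁻ x, avoid κ {z} (n + 1) x ∂p.toMeasure + p z * avoid κ {z} n z := by
    simp only [avoid_succ]
    rw [← lintegral_toMeasure_bind, hp, lintegral_indicator MeasurableSet.of_discrete, add_comm,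
      ← lintegral_add_compl _ (MeasurableSet.of_discrete (s := {z})), lintegral_singleton,
      mul_comm, ← apply_eq_toMeasure_singleton]
  have hpartial (m : ℕ) : ∑ n ∈ Finset.range m, p z * avoid κ {z} n z
      + ∫⁻ x, avoid κ {z} m x ∂p.toMeasure = 1 := by
    induction m with
    | zero => simp [avoid]
    | succ m ih => rw [Finset.sum_range_succ, add_assoc, add_comm (p z * _), ← hsplit, ih]
  rw [← ENNReal.tsum_mul_left, ENNReal.tsum_eq_iSup_nat]
  exact iSup_le fun m => le_self_add.trans_eq (hpartial m)

/-- Avoiding A up to time n + 1 entails being outside A at that time. The index is n + 1 because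
time 0 is not watched. -/
theorem avoid_add_measure_le_one (n : ℕ) (z : S) :
    avoid κ A (n + 1) z + (iterate κ (n + 1) z).toMeasure A ≤ 1 := by
  have hle : ∀ z, avoid κ A (n + 1) z ≤ (iterate κ (n + 1) z).toMeasure Aᶜ := by
    induction n with
    | zero =>
      intro z
      rw [iterate_one, ← lintegral_indicator_one MeasurableSet.of_discrete]
      exact le_rfl
    | succ n ih =>
      intro z
      rw [iterate_succ', ← lintegral_indicator_one MeasurableSet.of_discrete,
        lintegral_toMeasure_bind]
      refine lintegral_mono fun x => ?_
      rw [lintegral_indicator_one MeasurableSet.of_discrete]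
      exact (Set.indicator_le_self _ _ x).trans (ih x)
  calc _ ≤ (iterate κ (n + 1) z).toMeasure Aᶜ + (iterate κ (n + 1) z).toMeasure A := by
        gcongr; exact hle z
    _ = 1 := by rw [add_comm, measure_add_measure_compl MeasurableSet.of_discrete, measure_univ]

end Avoid

/-! ### Finite mean return times and absorption in the essential states. -/

section Recurrence

variable {S : Type*} [Countable S] [MeasurableSpace S] [MeasurableSingletonClass S]
  {κ : S → PMF S} {X : Set S} {W : S → ℝ≥0∞} {B : ℝ≥0∞}

/-- The probabilities to avoid an essential state are summable: its mean return time is finite. -/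
theorem IsEssential.tsum_avoid_lt_top (hW : ∀ c : ℝ≥0∞, c ≠ ∞ → {x | W x ≤ c}.Finite)
    (hB : B ≠ ∞) {z : S} (h : ∀ᶠ t in atTop, ∫⁻ x, W x ∂(iterate κ t z).toMeasure ≤ B)
    (hz : IsEssential κ z) : ∑' n, avoid κ {z} n z < ∞ := by
  obtain ⟨p, hp, hreach⟩ := exists_stationary hW hB h
  obtain ⟨y, hy⟩ := p.support_nonempty
  obtain ⟨t, ht⟩ := hz y (hreach y hy)
  have hpz : p z ≠ 0 := by
    rw [← mem_support_iff, ← bind_iterate κ hp t, mem_support_bind_iff]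
    exact ⟨y, hy, ht⟩
  by_contra htop
  have := tsum_avoid_singleton_le hp z
  rw [not_lt_top_iff.1 htop, ENNReal.mul_top hpz] at this
  exact absurd this (by simp)

/-- From a state at which the laws of the chain are eventually concentrated on a finite set, some
state of that set is reached. -/
theorem exists_reaches_le {c : ℝ≥0∞} (hc : c ≠ 0) (hc' : c ≠ ∞) (hBc : B / c < 1) {z : S}
    (h : ∀ᶠ t in atTop, ∫⁻ x, W x ∂(iterate κ t z).toMeasure ≤ B) :
    ∃ y ∈ {x | W x ≤ c}, Reaches κ z y := by
  obtain ⟨t, ht⟩ := h.exists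
  by_contra! hno
  have hsub : (iterate κ t z).support ⊆ {x | c ≤ W x} := fun y hy =>
    (lt_of_not_ge fun hle => hno y hle ⟨t, hy⟩ : c < W y).le
  have h1 := (toMeasure_apply_eq_one_iff _ MeasurableSet.of_discrete).2 hsub
  exact (h1.symm.le.trans (measure_ge_le_div _ ht hc hc')).not_gt hBc

/-- Let g be the probability of never entering the essential states and H its supremum over X. On a
finite sublevel set F, g is at most H d for some d < 1, since essential states are reached from each
of its points in X. From any state of X the chain is in F with probability at least 1/2 at some
time, so H ≤ H (d + (1 - d) / 2), which forces H = 0. -/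
theorem iInf_avoid_isEssential_eq_zero (hW : ∀ c : ℝ≥0∞, c ≠ ∞ → {x | W x ≤ c}.Finite)
    (hB : B ≠ ∞) (hX : ∀ z ∈ X, (κ z).support ⊆ X)
    (h : ∀ z ∈ X, ∀ᶠ t in atTop, ∫⁻ x, W x ∂(iterate κ t z).toMeasure ≤ B) {z : S} (hz : z ∈ X) :
    ⨅ n, avoid κ {x | IsEssential κ x} n z = 0 := by
  set A : Set S := {x | IsEssential κ x}
  obtain ⟨c, hc0, hctop, hBc⟩ : ∃ c : ℝ≥0∞, c ≠ 0 ∧ c ≠ ∞ ∧ B / c ≤ 2⁻¹ := by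
    -- The summand 1 keeps c nonzero when B = 0.
    refine ⟨2 * B + 1, by simp, by finiteness, ENNReal.div_le_of_le_mul ?_⟩
    rw [mul_add, ← mul_assoc, ENNReal.inv_mul_cancel (by simp) (by simp), one_mul]
    exact le_self_add
  have hBc1 : B / c < 1 := hBc.trans_lt (by simp)
  set F : Set S := {x | W x ≤ c}
  let g (z : S) : ℝ≥0∞ := ⨅ n, avoid κ A n z
  let H : ℝ≥0∞ := ⨆ z ∈ X, g z
  have hgH {z : S} (hz : z ∈ X) : g z ≤ H := le_iSup₂ (f := fun z (_ : z ∈ X) => g z) z hz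
  have hH1 : H ≤ 1 := iSup₂_le fun z _ => (iInf_le _ 0).trans (avoid_le_one κ A 0 z)
  have hg (z : S) : g z ≤ ∫⁻ x, Aᶜ.indicator g x ∂(κ z).toMeasure := by
    have hind (x : S) : Aᶜ.indicator g x = ⨅ n, Aᶜ.indicator (avoid κ A n) x := by
      by_cases hx : x ∈ A <;> simp [hx, g]
    simp only [hind]
    rw [lintegral_iInf (f := fun n => Aᶜ.indicator (avoid κ A n))
      (fun _ => Measurable.of_discrete)
      (fun a b hab x => Set.indicator_le_indicator (antitone_avoid κ A x hab))]
    · exact le_iInf fun n => iInf_le _ (n + 1)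
    · refine ne_top_of_le_ne_top ENNReal.one_ne_top (avoid_le_one κ A 1 z)
  -- To avoid forever, first avoid for n steps; from there the chance is at most H.
  have hgavoid (n : ℕ) : ∀ z ∈ X, g z ≤ H * avoid κ A n z := by
    induction n with
    | zero => intro z hz; simpa [avoid] using hgH hz
    | succ n ih =>
      intro z hz
      rw [avoid_succ, ← lintegral_const_mul _ Measurable.of_discrete]
      refine (hg z).trans (lintegral_mono_support _ fun x hx => ?_)
      by_cases hxA : x ∈ A
      · simp [hxA]
      · simpa [hxA] using ih x (hX z hz hx)
  have hgiter (t : ℕ) : ∀ z, g z ≤ ∫⁻ x, g x ∂(iterate κ t z).toMeasure := by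
    induction t with
    | zero => intro z; rw [iterate_zero, lintegral_toMeasure_pure]
    | succ t ih =>
      intro z
      rw [iterate_succ', lintegral_toMeasure_bind]
      exact (hg z).trans (lintegral_mono fun x => (Set.indicator_le_self _ _ x).trans (ih x))
  have hlt (f : S) (hf : f ∈ X) : ∃ n, avoid κ A n f < 1 := by
    obtain ⟨y, ⟨t, hty⟩, hy⟩ := exists_reaches_isEssential hX (hW c hctop)
      (fun z hz => exists_reaches_le hc0 hctop hBc1 (h z hz)) hf
    -- One more step is taken because f may itself be y, and a visit at time 0 does not count. A
    -- successor of an essential state is again essential.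
    obtain ⟨x, hx⟩ := (κ y).support_nonempty
    have hpos : (iterate κ (t + 1) f).toMeasure A ≠ 0 := by
      have hxA : x ∈ A := hy.of_reaches (Reaches.of_mem_support hx)
      have hxt : x ∈ (iterate κ (t + 1) f).support := by
        rw [iterate_succ, mem_support_bind_iff]; exact ⟨y, hty, hx⟩
      rw [Ne, toMeasure_apply_eq_zero_iff _ MeasurableSet.of_discrete]
      exact Set.not_disjoint_iff.2 ⟨x, hxt, hxA⟩
    refine ⟨t + 1, lt_of_lt_of_le ?_ (avoid_add_measure_le_one κ A t f)⟩
    exact ENNReal.lt_add_right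
      (ne_top_of_le_ne_top ENNReal.one_ne_top (avoid_le_one κ A _ f)) hpos
  obtain ⟨d, hd1, hd⟩ : ∃ d < 1, ∀ f ∈ F ∩ X, g f ≤ H * d := by
    choose! n hn using hlt
    have hfin : (F ∩ X).Finite := (hW c hctop).inter_of_left X
    refine ⟨hfin.toFinset.sup fun f => avoid κ A (n f) f, ?_, fun f hf => ?_⟩
    · exact (Finset.sup_lt_iff (by simp)).2 fun f hf => hn f ((hfin.mem_toFinset.1 hf).2)
    · exact (hgavoid (n f) f hf.2).trans (mul_le_mul_right
        (Finset.le_sup (f := fun f => avoid κ A (n f) f) (hfin.mem_toFinset.2 hf)) _)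
  have hHle : H ≤ H * (d + (1 - d) * 2⁻¹) := by
    refine iSup₂_le fun z hz => ?_
    obtain ⟨t, ht⟩ := (h z hz).exists
    calc g z ≤ ∫⁻ x, g x ∂(iterate κ t z).toMeasure := hgiter t z
      _ ≤ ∫⁻ x, H * (d + (1 - d) * {x | c ≤ W x}.indicator 1 x) ∂(iterate κ t z).toMeasure := by
          refine lintegral_mono_support _ fun x hx => ?_
          have hxX := support_iterate_subset hX hz t hx
          by_cases hxF : x ∈ F
          · exact (hd x ⟨hxF, hxX⟩).trans (mul_le_mul_right le_self_add _)
          · have hxW : x ∈ {x | c ≤ W x} := (lt_of_not_ge hxF : c < W x).le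
            rw [Set.indicator_of_mem hxW, Pi.one_apply, mul_one, add_tsub_cancel_of_le hd1.le,
              mul_one]
            exact hgH hxX
      _ = H * (d + (1 - d) * (iterate κ t z).toMeasure {x | c ≤ W x}) := by
          rw [lintegral_const_mul _ Measurable.of_discrete,
            lintegral_add_left Measurable.of_discrete,
            lintegral_const_mul _ Measurable.of_discrete,
            lintegral_indicator_one MeasurableSet.of_discrete]
          simp
      _ ≤ H * (d + (1 - d) * 2⁻¹) := by
          gcongr
          exact (measure_ge_le_div _ ht hc0 hctop).trans hBc
  have hdd : d + (1 - d) * 2⁻¹ < 1 := by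
    have hdtop : d ≠ ∞ := (hd1.trans_le le_top).ne
    calc d + (1 - d) * 2⁻¹ < d + (1 - d) := by
          refine ENNReal.add_lt_add_left hdtop ?_
          conv_rhs => rw [← mul_one (1 - d)]
          exact ENNReal.mul_lt_mul_right (tsub_pos_of_lt hd1).ne' (by finiteness) (by simp)
      _ = 1 := add_tsub_cancel_of_le hd1.le
  have hH0 : H = 0 := by
    by_contra hne
    refine hHle.not_gt ?_
    conv_rhs => rw [← mul_one H]
    exact ENNReal.mul_lt_mul_right hne (ne_top_of_le_ne_top ENNReal.one_ne_top hH1) hdd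
  exact le_antisymm ((hgH hz).trans hH0.le) bot_le

end Recurrence

end PMF

/-! ### The Markov property of the path law. -/

namespace LoadBalancing

variable {N : ℕ} {M : Type*} [Finite M] [MeasurableSpace M] [MeasurableSingletonClass M]
  (L : LoadBalancing N M) (ε : ℝ) (init : PMF (LBState N M))

instance : IsProbabilityMeasure (L.pathLaw ε init) := by
  rw [pathLaw]
  infer_instance

theorem lintegral_withSlot (p : PMF (LBState N M)) (f : LBState N M × LBSlot N → ℝ≥0∞) :
    ∫⁻ y, f y ∂(L.withSlot ε p).toMeasure
      = ∫⁻ z, ∫⁻ w, f (z, w) ∂(L.slotLaw ε z).toMeasure ∂p.toMeasure := by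
  rw [withSlot, PMF.lintegral_toMeasure_bind]
  exact lintegral_congr fun z => PMF.lintegral_toMeasure_map _ _ _

theorem lintegral_step (z : LBState N M) (g : LBState N M → ℝ≥0∞) :
    ∫⁻ x, g x ∂(L.step ε z).toMeasure
      = ∫⁻ w, ∫⁻ x, g x ∂(L.next z w).toMeasure ∂(L.slotLaw ε z).toMeasure :=
  PMF.lintegral_toMeasure_bind _ _ _

theorem map_zero_pathLaw :
    (L.pathLaw ε init).map (fun ω => ω 0) = (L.withSlot ε init).toMeasure := by
  rw [pathLaw, Kernel.trajMeasure, Measure.map_comp _ _ (by fun_prop)]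
  have h0 : (fun ω : ℕ → LBState N M × LBSlot N => ω 0)
      = (fun x : (i : Finset.Iic 0) → LBState N M × LBSlot N => x ⟨0, by simp⟩)
        ∘ Preorder.frestrictLe 0 := rfl
  rw [h0, Kernel.map_comp_right _ (Preorder.measurable_frestrictLe 0) (by fun_prop), Kernel.traj_map_frestrictLe,
    Kernel.partialTraj_self, ← Measure.map_comp _ _ (by fun_prop), Measure.id_comp,
    Measure.map_map (by fun_prop) (by fun_prop)]
  exact Measure.map_id

/-- The Markov property of the sequence of states and slots. -/
theorem lintegral_pathLaw_succ (n : ℕ)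
    {f : ((Finset.Iic n → LBState N M × LBSlot N) × (LBState N M × LBSlot N)) → ℝ≥0∞}
    (hf : Measurable f) :
    ∫⁻ ω, f (Preorder.frestrictLe n ω, ω (n + 1)) ∂(L.pathLaw ε init)
      = ∫⁻ ω, ∫⁻ y, f (Preorder.frestrictLe n ω, y)
          ∂(L.withSlot ε (L.next (ω n).1 (ω n).2)).toMeasure ∂(L.pathLaw ε init) := by
  rw [← lintegral_map (g := fun ω => (Preorder.frestrictLe n ω, ω (n + 1))) hf (by fun_prop),
    pathLaw, ← Kernel.map_frestrictLe_trajMeasure_compProd_eq_map_trajMeasure,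
    Measure.lintegral_compProd hf, lintegral_map (by fun_prop) (by fun_prop)]
  rfl

/-- Given the states up to time `n`, the slot at time `n` is drawn from the slot law. -/
theorem lintegral_pathLaw_slot (n : ℕ) (F : (ℕ → LBState N M) → ℝ≥0∞)
    (f : LBState N M × LBSlot N → ℝ≥0∞) :
    ∫⁻ ω, F (fun i => (ω (min i n)).1) * f (ω n) ∂(L.pathLaw ε init)
      = ∫⁻ ω, F (fun i => (ω (min i n)).1) *
          ∫⁻ w, f ((ω n).1, w) ∂(L.slotLaw ε (ω n).1).toMeasure ∂(L.pathLaw ε init) := by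
  -- Freezing the path at time n through `min i n` makes F an arbitrary function of the states up to
  -- time n. Given these, the slot is a fresh draw, which is all that has to be checked under
  -- `withSlot`.
  have key (p : PMF (LBState N M)) (G : LBState N M → ℝ≥0∞) :
      ∫⁻ y, G y.1 * f y ∂(L.withSlot ε p).toMeasure
        = ∫⁻ y, G y.1 * ∫⁻ w, f (y.1, w) ∂(L.slotLaw ε y.1).toMeasure
            ∂(L.withSlot ε p).toMeasure := by
    rw [lintegral_withSlot, lintegral_withSlot]
    refine lintegral_congr fun z => ?_
    dsimp only
    rw [lintegral_const_mul _ Measurable.of_discrete]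
    simp
  cases n with
  | zero =>
    have h (g : LBState N M × LBSlot N → ℝ≥0∞) :
        ∫⁻ ω, F (fun _ => (ω 0).1) * g (ω 0) ∂(L.pathLaw ε init)
          = ∫⁻ y, F (fun _ => y.1) * g y ∂(L.withSlot ε init).toMeasure := by
      rw [← map_zero_pathLaw, lintegral_map Measurable.of_discrete (by fun_prop)]
    simp only [Nat.min_zero]
    rw [h, h fun y => ∫⁻ w, f (y.1, w) ∂(L.slotLaw ε y.1).toMeasure]
    exact key init fun z => F fun _ => z
  | succ n =>
    let E (x : Finset.Iic n → LBState N M × LBSlot N) (z : LBState N M) (i : ℕ) : LBState N M :=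
      if h : i ≤ n then (x ⟨i, Finset.mem_Iic.2 h⟩).1 else z
    have hE (ω : ℕ → LBState N M × LBSlot N) :
        (fun i => (ω (min i (n + 1))).1) = E (Preorder.frestrictLe n ω) (ω (n + 1)).1 := by
      funext i
      by_cases hi : i ≤ n
      · simp [E, hi, Nat.le_succ_of_le hi]
      · simp [E, hi, Nat.succ_le_of_lt (not_le.1 hi)]
    simp only [hE]
    have h (g : LBState N M × LBSlot N → ℝ≥0∞) := L.lintegral_pathLaw_succ ε init n
      (f := fun q => F (E q.1 q.2.1) * g q.2) Measurable.of_discrete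
    rw [h, h fun y => ∫⁻ w, f (y.1, w) ∂(L.slotLaw ε y.1).toMeasure]
    exact lintegral_congr fun ω => key _ fun z => F (E _ z)

/-- The Markov property of the sequence of states. -/
theorem lintegral_pathLaw_state_succ (n : ℕ) (F : (ℕ → LBState N M) → ℝ≥0∞)
    (g : LBState N M → ℝ≥0∞) :
    ∫⁻ ω, F (fun i => (ω (min i n)).1) * g (ω (n + 1)).1 ∂(L.pathLaw ε init)
      = ∫⁻ ω, F (fun i => (ω (min i n)).1) * ∫⁻ x, g x ∂(L.step ε (ω n).1).toMeasure
          ∂(L.pathLaw ε init) := by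
  have h := L.lintegral_pathLaw_succ ε init n
    (f := fun q => F (fun i => (q.1 ⟨min i n, by simp⟩).1) * g q.2.1) Measurable.of_discrete
  refine h.trans ?_
  simp only [Preorder.frestrictLe_apply]
  simp only [lintegral_const_mul _ (Measurable.of_discrete (f := fun y : LBState N M × LBSlot N =>
    g y.1)), lintegral_withSlot, lintegral_const, measure_univ, mul_one]
  rw [L.lintegral_pathLaw_slot ε init n F fun y => ∫⁻ x, g x ∂(L.next y.1 y.2).toMeasure]
  simp only [lintegral_step]

theorem lintegral_pathLaw_state (n : ℕ) (g : LBState N M → ℝ≥0∞) :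
    ∫⁻ ω, g (ω n).1 ∂(L.pathLaw ε init)
      = ∫⁻ x, g x ∂(init.bind (PMF.iterate (L.step ε) n)).toMeasure := by
  induction n generalizing g with
  | zero =>
    have h : init.bind (PMF.iterate (L.step ε) 0) = init := PMF.bind_pure init
    rw [h, ← lintegral_map (f := fun y : LBState N M × LBSlot N => g y.1)
      (g := fun ω : ℕ → LBState N M × LBSlot N => ω 0) Measurable.of_discrete (by fun_prop),
      map_zero_pathLaw, lintegral_withSlot]
    simp
  | succ n ih =>
    have h := L.lintegral_pathLaw_state_succ ε init n (fun _ => 1) g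
    simp only [one_mul] at h
    rw [h, ih fun z => ∫⁻ x, g x ∂(L.step ε z).toMeasure, ← PMF.lintegral_toMeasure_bind,
      PMF.bind_bind]
    rfl

theorem pathLaw_state_preimage (n : ℕ) (A : Set (LBState N M)) :
    L.pathLaw ε init {ω | (ω n).1 ∈ A}
      = (init.bind (PMF.iterate (L.step ε) n)).toMeasure A := by
  have hA : MeasurableSet {ω : ℕ → LBState N M × LBSlot N | (ω n).1 ∈ A} :=
    (by fun_prop : Measurable fun ω : ℕ → LBState N M × LBSlot N => (ω n).1)
      (MeasurableSet.of_discrete (s := A))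
  rw [← lintegral_indicator_one hA, ← lintegral_indicator_one (MeasurableSet.of_discrete (s := A)),
    ← lintegral_pathLaw_state]
  rfl

theorem pathLaw_state_eq (n : ℕ) (z : LBState N M) :
    L.pathLaw ε init {ω | (ω n).1 = z} = init.bind (PMF.iterate (L.step ε) n) z := by
  rw [PMF.apply_eq_toMeasure_singleton, ← pathLaw_state_preimage]
  rfl

/-- The law of the state at time `a + n`, on the event that the state at time `a` is `z`. -/
theorem lintegral_pathLaw_restrict (a n : ℕ) (z : LBState N M) (g : LBState N M → ℝ≥0∞) :
    ∫⁻ ω in {ω | (ω a).1 = z}, g (ω (a + n)).1 ∂(L.pathLaw ε init)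
      = L.pathLaw ε init {ω | (ω a).1 = z} *
          ∫⁻ x, g x ∂(PMF.iterate (L.step ε) n z).toMeasure := by
  have hz : MeasurableSet {ω : ℕ → LBState N M × LBSlot N | (ω a).1 = z} :=
    (by fun_prop : Measurable fun ω : ℕ → LBState N M × LBSlot N => (ω a).1)
      (measurableSet_singleton z)
  induction n generalizing g with
  | zero =>
    rw [PMF.iterate_zero, PMF.lintegral_toMeasure_pure, mul_comm, ← setLIntegral_const]
    exact setLIntegral_congr_fun hz fun ω hω => congrArg g hω
  | succ n ih =>
    -- As a ≤ a + n, freezing the path at a + n does not affect this indicator.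
    let F (σ : ℕ → LBState N M) : ℝ≥0∞ := {σ : ℕ → LBState N M | σ a = z}.indicator 1 σ
    have hFω (ω : ℕ → LBState N M × LBSlot N) (b : ℝ≥0∞) :
        F (fun i => (ω (min i (a + n))).1) * b
          = {ω : ℕ → LBState N M × LBSlot N | (ω a).1 = z}.indicator (fun _ => b) ω := by
      by_cases h : (ω a).1 = z <;> simp [F, h]
    have h := L.lintegral_pathLaw_state_succ ε init (a + n) F g
    simp only [hFω] at h
    have hl (f : (ℕ → LBState N M × LBSlot N) → ℝ≥0∞) :
        ∫⁻ ω, {ω : ℕ → LBState N M × LBSlot N | (ω a).1 = z}.indicator (fun _ => f ω) ω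
            ∂(L.pathLaw ε init)
          = ∫⁻ ω in {ω | (ω a).1 = z}, f ω ∂(L.pathLaw ε init) := by
      rw [← lintegral_indicator hz]
      rfl
    rw [hl, hl] at h
    rw [← add_assoc, h, ih fun z => ∫⁻ x, g x ∂(L.step ε z).toMeasure,
      ← PMF.lintegral_toMeasure_bind]
    rfl

/-- The law of the state at time `a + n`, given that the state at time `a` is `z`. -/
theorem lintegral_cond_pathLaw {a : ℕ} {z : LBState N M}
    (hz : L.pathLaw ε init {ω | (ω a).1 = z} ≠ 0) (n : ℕ) (g : LBState N M → ℝ≥0∞) :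
    ∫⁻ ω, g (ω (a + n)).1 ∂(ProbabilityTheory.cond (L.pathLaw ε init) {ω | (ω a).1 = z})
      = ∫⁻ x, g x ∂(PMF.iterate (L.step ε) n z).toMeasure := by
  rw [ProbabilityTheory.cond, lintegral_smul_measure, lintegral_pathLaw_restrict, smul_eq_mul,
    ← mul_assoc, ENNReal.inv_mul_cancel hz (measure_ne_top _ _), one_mul]

/-- The recursion for `avoid` peels off the first step, the path law the last one. The induction
therefore treats a mixed quantity: A is avoided along the path up to time n, then m more times in
the recursive sense. -/
theorem pathLaw_pure_avoid (z : LBState N M) (A : Set (LBState N M)) (n : ℕ) :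
    L.pathLaw ε (PMF.pure z) {ω | ∀ k ∈ Set.Icc 1 n, (ω k).1 ∉ A}
      = PMF.avoid (L.step ε) A n z := by
  let C (n : ℕ) : Set (ℕ → LBState N M) := {σ | ∀ k ∈ Set.Icc 1 n, σ k ∉ A}
  have hC (n : ℕ) : MeasurableSet (C n) := by
    simp only [C, Set.ofPred_forall]
    exact MeasurableSet.iInter fun k => MeasurableSet.iInter fun _ =>
      (measurable_pi_apply k : Measurable fun σ : ℕ → LBState N M => σ k)
        (MeasurableSet.of_discrete (s := Aᶜ))
  have hCmin (n : ℕ) (ω : ℕ → LBState N M × LBSlot N) :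
      (C n).indicator (1 : (ℕ → LBState N M) → ℝ≥0∞) (fun i => (ω (min i n)).1)
        = (C n).indicator 1 fun i => (ω i).1 := by
    have : (fun i => (ω (min i n)).1) ∈ C n ↔ (fun i => (ω i).1) ∈ C n :=
      forall₂_congr fun k hk => by simp [hk.2]
    by_cases h : (fun i => (ω i).1) ∈ C n
    · rw [Set.indicator_of_mem h, Set.indicator_of_mem (this.2 h)]; rfl
    · rw [Set.indicator_of_notMem h, Set.indicator_of_notMem (mt this.1 h)]
  have key (n m : ℕ) : ∫⁻ ω, (C n).indicator 1 (fun i => (ω i).1) *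
      PMF.avoid (L.step ε) A m (ω n).1 ∂(L.pathLaw ε (PMF.pure z))
        = PMF.avoid (L.step ε) A (n + m) z := by
    induction n generalizing m with
    | zero =>
      have : C 0 = Set.univ := Set.eq_univ_of_forall fun σ k hk => by
        have := hk.1.trans hk.2; omega
      simp only [this, Set.indicator_univ, Pi.one_apply, one_mul]
      rw [lintegral_pathLaw_state, PMF.pure_bind, PMF.iterate_zero, PMF.lintegral_toMeasure_pure,
        zero_add]
    | succ n ih =>
      have hsplit (ω : ℕ → LBState N M × LBSlot N) :
          (C (n + 1)).indicator 1 (fun i => (ω i).1) * PMF.avoid (L.step ε) A m (ω (n + 1)).1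
            = (C n).indicator 1 (fun i => (ω (min i n)).1) *
                Aᶜ.indicator (PMF.avoid (L.step ε) A m) (ω (n + 1)).1 := by
        rw [hCmin]
        have : (fun i => (ω i).1) ∈ C (n + 1) ↔
            (fun i => (ω i).1) ∈ C n ∧ (ω (n + 1)).1 ∉ A :=
          ⟨fun h => ⟨fun k hk => h k ⟨hk.1, hk.2.trans n.le_succ⟩, h _ ⟨by omega, le_rfl⟩⟩,
            fun h k hk => (Nat.le_succ_iff.1 hk.2).elim (fun hkn => h.1 k ⟨hk.1, hkn⟩)
              fun hkn => hkn ▸ h.2⟩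
        by_cases h1 : (fun i => (ω i).1) ∈ C n <;> by_cases h2 : (ω (n + 1)).1 ∈ A <;>
          simp [this, h1, h2]
      simp only [hsplit]
      rw [L.lintegral_pathLaw_state_succ ε _ n ((C n).indicator 1)]
      simp only [hCmin, ← PMF.avoid_succ]
      rw [ih (m + 1)]
      congr 1; omega
  have h := key n 0
  simp only [PMF.avoid, mul_one, add_zero] at h
  have hmeas : MeasurableSet {ω : ℕ → LBState N M × LBSlot N | ∀ k ∈ Set.Icc 1 n, (ω k).1 ∉ A} :=
    (by fun_prop : Measurable fun (ω : ℕ → LBState N M × LBSlot N) i => (ω i).1) (hC n)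
  rw [← h, ← lintegral_indicator_one hmeas]
  rfl

end LoadBalancing

/-! ### From geometric drift to a bound at all late times. -/

namespace PMF

variable {S : Type*} [Countable S] [MeasurableSpace S] [MeasurableSingletonClass S]

/-- A geometric drift condition over `T` steps, valid at all states visited after time `0`, and
bounded growth in one step give a bound on the expectation of `W` at all late times. -/
theorem eventually_lintegral_iterate_le {κ : S → PMF S} {X : Set S} {W : S → ℝ≥0∞}
    (hX : ∀ z ∈ X, (κ z).support ⊆ X) {T : ℕ} {ρ C G : ℝ≥0∞} (hT : 0 < T) (hρ : ρ < 1)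
    (hG : 1 ≤ G) (hG' : G ≠ ∞) (hW : ∀ z, W z ≠ ∞)
    (hdrift : ∀ z₀ ∈ X, ∀ z ∈ (κ z₀).support,
      ∫⁻ x, W x ∂(iterate κ T z).toMeasure ≤ ρ * W z + C)
    (hgrowth : ∀ z ∈ X, ∀ x ∈ (κ z).support, W x ≤ G * W z) {z : S} (hz : z ∈ X) :
    ∀ᶠ t in atTop, ∫⁻ x, W x ∂(iterate κ t z).toMeasure ≤ G ^ T * (1 + C * (1 - ρ)⁻¹) := by
  -- The fixed point of x ↦ ρ x + C, so the bound reproduces itself under a block of T steps.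
  set C' := C * (1 - ρ)⁻¹
  have hC' : ρ * C' + C = C' := by
    have h1 : C = (1 - ρ) * C' := by
      rw [mul_left_comm, ENNReal.mul_inv_cancel (tsub_pos_of_lt hρ).ne' (by finiteness), mul_one]
    conv_lhs => rw [h1, ← add_mul, add_tsub_cancel_of_le hρ.le, one_mul]
  -- The drift is known only at states entered by a transition from X; this set of states is closed
  -- under the dynamics.
  let R : Set S := {y | ∃ z ∈ X, y ∈ (κ z).support}
  have hR (y : S) (hy : y ∈ R) : (κ y).support ⊆ R := by
    obtain ⟨z, hz, hy⟩ := hy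
    exact fun x hx => ⟨y, hX z hz hy, hx⟩
  have hgeom (k : ℕ) (y : S) (hy : y ∈ R) :
      ∫⁻ x, W x ∂(iterate κ (T * k) y).toMeasure ≤ ρ ^ k * W y + C' := by
    induction k with
    | zero => simp [iterate_zero, lintegral_toMeasure_pure]
    | succ k ih =>
      rw [Nat.mul_succ, iterate_add, lintegral_toMeasure_bind]
      calc _ ≤ ∫⁻ x, ρ * W x + C ∂(iterate κ (T * k) y).toMeasure := by
            refine lintegral_mono_support _ fun x hx => ?_
            obtain ⟨z₀, hz₀, hx⟩ := support_iterate_subset hR hy _ hx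
            exact hdrift z₀ hz₀ x hx
        _ = ρ * ∫⁻ x, W x ∂(iterate κ (T * k) y).toMeasure + C := by
            rw [lintegral_add_left Measurable.of_discrete,
              lintegral_const_mul _ Measurable.of_discrete]
            simp
        _ ≤ ρ * (ρ ^ k * W y + C') + C := by gcongr
        _ = ρ ^ (k + 1) * W y + C' := by rw [mul_add, add_assoc, hC', ← mul_assoc, pow_succ']
  have hgrow (s j : ℕ) : ∫⁻ x, W x ∂(iterate κ (s + j) z).toMeasure
      ≤ G ^ j * ∫⁻ x, W x ∂(iterate κ s z).toMeasure := by
    induction j with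
    | zero => simp
    | succ j ih =>
      rw [← add_assoc, iterate_succ, lintegral_toMeasure_bind]
      calc _ ≤ ∫⁻ x, G * W x ∂(iterate κ (s + j) z).toMeasure := by
            refine lintegral_mono_support _ fun x hx => ?_
            calc _ ≤ ∫⁻ _, G * W x ∂(κ x).toMeasure :=
                  lintegral_mono_support _ fun y hy =>
                    hgrowth x (support_iterate_subset hX hz _ hx) y hy
              _ = _ := by simp
        _ ≤ G * (G ^ j * ∫⁻ x, W x ∂(iterate κ s z).toMeasure) := by
            rw [lintegral_const_mul _ Measurable.of_discrete]
            gcongr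
        _ = _ := by rw [← mul_assoc, pow_succ']
  have hlim : Tendsto (fun t : ℕ => ρ ^ ((t - 1) / T) * (G * W z)) atTop (𝓝 0) := by
    have h1 : Tendsto (fun t : ℕ => (t - 1) / T) atTop atTop :=
      (Nat.tendsto_div_const_atTop hT.ne').comp (tendsto_sub_atTop_nat 1)
    have h2 := ENNReal.Tendsto.mul_const (b := G * W z)
      ((ENNReal.tendsto_pow_atTop_nhds_zero_of_lt_one hρ).comp h1)
      (Or.inr (ENNReal.mul_ne_top hG' (hW z)))
    simpa using h2
  filter_upwards [eventually_ge_atTop 1, hlim.eventually_le_const zero_lt_one] with t ht ht'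
  set k := (t - 1) / T
  -- One step to enter R, then k blocks with geometric drift, then fewer than T steps, each costing
  -- at most a factor G.
  have htk : t = 1 + T * k + (t - 1) % T := by
    have : T * k + (t - 1) % T = t - 1 := Nat.div_add_mod (t - 1) T
    omega
  calc ∫⁻ x, W x ∂(iterate κ t z).toMeasure
      ≤ G ^ ((t - 1) % T) * ∫⁻ x, W x ∂(iterate κ (1 + T * k) z).toMeasure := by
        conv_lhs => rw [htk]
        exact hgrow _ _
    _ ≤ G ^ T * (1 + C') := by
        refine mul_le_mul' (pow_le_pow_right₀ hG (Nat.mod_lt _ hT).le) ?_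
        rw [iterate_add, iterate_one, lintegral_toMeasure_bind]
        calc _ ≤ ∫⁻ _, ρ ^ k * (G * W z) + C' ∂(κ z).toMeasure := by
              refine lintegral_mono_support _ fun y hy => (hgeom k y ⟨z, hz, hy⟩).trans ?_
              gcongr
              exact hgrowth z hz y hy
          _ ≤ 1 + C' := by
              rw [lintegral_const, measure_univ, mul_one]
              gcongr

end PMF

/-! ### Recurrence and stability of the system from bounded expectations. -/

namespace LoadBalancing

section

variable {N : ℕ} {M : Type*} (L : LoadBalancing N M) {ε : ℝ}

theorem mem_support_serviceLaw {v : Fin N → ℕ} (hv : v ∈ L.serviceLaw.support) (n : Fin N) :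
    v n ∈ (L.service n).support := by
  rw [PMF.mem_support_iff, serviceLaw, Measure.toPMF_apply, Measure.pi_singleton,
    Finset.prod_ne_zero_iff] at hv
  rw [PMF.mem_support_iff, PMF.apply_eq_toMeasure_singleton]
  exact hv n (Finset.mem_univ n)

theorem mem_support_slotLaw {z : LBState N M} {w : LBSlot N}
    (hw : w ∈ (L.slotLaw ε z).support) :
    w.1 ∈ (L.dispatch z).support ∧ w.2.1 ∈ (L.arrival ε).support ∧
      ∀ n, w.2.2 n ∈ (L.service n).support := by
  simp only [slotLaw, PMF.mem_support_bind_iff, PMF.mem_support_map_iff] at hw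
  obtain ⟨s, hs, a, ha, v, hv, rfl⟩ := hw
  exact ⟨hs, ha, L.mem_support_serviceLaw hv⟩

theorem step_support_subset (hε : ε ∈ Ioc 0 L.muSum) {z : LBState N M} (hz : z ∈ L.space) :
    (L.step ε z).support ⊆ L.space := by
  intro z' hz'
  simp only [step, next, PMF.mem_support_bind_iff, PMF.mem_support_map_iff] at hz'
  obtain ⟨w, hw, m, hm, rfl⟩ := hz'
  obtain ⟨hs, ha, hv⟩ := L.mem_support_slotLaw hw
  exact L.space_closed ε hε z hz w.1 hs w.2.1 ha w.2.2 hv m hm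

/-- A natural number is the count of the smaller ones: the summand is 1 for every n below the return
time, and for all n if there is no return. -/
theorem returnTime_le_tsum (z : LBState N M) (ω : ℕ → LBState N M × LBSlot N) :
    returnTime z ω ≤ ∑' n : ℕ,
      {ω : ℕ → LBState N M × LBSlot N | ∀ k ∈ Icc 1 n, (ω k).1 ∉ ({z} : Set _)}.indicator 1 ω := by
  classical
  by_cases h : ∃ t, 1 ≤ t ∧ (ω t).1 = z
  · calc returnTime z ω ≤ (Nat.find h : ℝ≥0∞) :=
          iInf_le_of_le (Nat.find h) (iInf₂_le (Nat.find_spec h).1 (Nat.find_spec h).2)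
      _ = ∑ n ∈ Finset.range (Nat.find h), {ω : ℕ → LBState N M × LBSlot N |
            ∀ k ∈ Icc 1 n, (ω k).1 ∉ ({z} : Set _)}.indicator 1 ω := by
          have hmem (n : ℕ) (hn : n ∈ Finset.range (Nat.find h)) :
              ω ∈ {ω : ℕ → LBState N M × LBSlot N |
                ∀ k ∈ Icc 1 n, (ω k).1 ∉ ({z} : Set _)} := fun k hk hkz =>
            Nat.find_min h (hk.2.trans_lt (Finset.mem_range.1 hn)) ⟨hk.1, hkz⟩
          rw [Finset.sum_congr rfl fun n hn => Set.indicator_of_mem (hmem n hn) _]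
          simp
      _ ≤ _ := ENNReal.sum_le_tsum _
  · have hmem (n : ℕ) : ω ∈ {ω : ℕ → LBState N M × LBSlot N |
        ∀ k ∈ Icc 1 n, (ω k).1 ∉ ({z} : Set _)} := fun k hk hkz => h ⟨k, hk.1, hkz⟩
    rw [tsum_congr fun n => Set.indicator_of_mem (hmem n) _]
    simp

end

variable {N : ℕ} {M : Type*} [Finite M] [MeasurableSpace M] [MeasurableSingletonClass M]
  (L : LoadBalancing N M) {ε : ℝ}

theorem accessible_iff {z z' : LBState N M} :
    L.Accessible ε z z' ↔ PMF.Reaches (L.step ε) z z' := by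
  simp only [Accessible, PMF.Reaches, pathLaw_state_eq, PMF.pure_bind, PMF.mem_support_iff]

theorem essential_iff {z : LBState N M} : L.Essential ε z ↔ PMF.IsEssential (L.step ε) z := by
  simp only [Essential, PMF.IsEssential, accessible_iff]

theorem lintegral_returnTime_le (z : LBState N M) :
    ∫⁻ ω, returnTime z ω ∂(L.pathLaw ε (PMF.pure z)) ≤ ∑' n, PMF.avoid (L.step ε) {z} n z := by
  have hmeas (n : ℕ) : MeasurableSet
      {ω : ℕ → LBState N M × LBSlot N | ∀ k ∈ Icc 1 n, (ω k).1 ∉ ({z} : Set _)} := by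
    simp only [Set.ofPred_forall]
    exact MeasurableSet.iInter fun k => MeasurableSet.iInter fun _ =>
      (by fun_prop : Measurable fun ω : ℕ → LBState N M × LBSlot N => (ω k).1)
        (MeasurableSet.of_discrete (s := {z}ᶜ))
  refine (lintegral_mono (returnTime_le_tsum z)).trans ?_
  rw [lintegral_tsum fun n => (measurable_one.indicator (hmeas n)).aemeasurable]
  exact ENNReal.tsum_le_tsum fun n => by
    rw [lintegral_indicator_one (hmeas n), pathLaw_pure_avoid]

variable {L} {W : LBState N M → ℝ≥0∞} {B : ℝ≥0∞}

theorem positiveRecurrent_of_tight (hε : ε ∈ Ioc 0 L.muSum)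
    (hW : ∀ c : ℝ≥0∞, c ≠ ∞ → {x | W x ≤ c}.Finite) (hB : B ≠ ∞)
    (h : ∀ z ∈ L.space, ∀ᶠ t in atTop,
      ∫⁻ x, W x ∂(PMF.iterate (L.step ε) t z).toMeasure ≤ B) :
    L.PositiveRecurrent ε := by
  refine ⟨fun z hz hess => (L.lintegral_returnTime_le z).trans_lt
    ((L.essential_iff.1 hess).tsum_avoid_lt_top hW hB (h z hz)), fun z hz => ?_⟩
  rw [ae_iff, ← le_zero_iff,
    ← PMF.iInf_avoid_isEssential_eq_zero hW hB (fun z hz => L.step_support_subset hε hz) h hz]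
  refine le_iInf fun n => ?_
  rw [← pathLaw_pure_avoid]
  refine measure_mono fun ω hω k _ hk => hω ⟨k, L.essential_iff.2 hk⟩

theorem exists_isStationary_of_tight (hε : ε ∈ Ioc 0 L.muSum)
    (hW : ∀ c : ℝ≥0∞, c ≠ ∞ → {x | W x ≤ c}.Finite) (hB : B ≠ ∞)
    (h : ∀ z ∈ L.space, ∀ᶠ t in atTop,
      ∫⁻ x, W x ∂(PMF.iterate (L.step ε) t z).toMeasure ≤ B) :
    ∃ p, L.IsStationary ε p := by
  obtain ⟨z, hz⟩ := L.space_nonempty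
  obtain ⟨p, hp, hreach⟩ := PMF.exists_stationary hW hB (h z hz)
  refine ⟨p, fun y hy => ?_, hp⟩
  obtain ⟨t, ht⟩ := hreach y hy
  exact PMF.support_iterate_subset (fun z hz => L.step_support_subset hε hz) hz t ht

/-- W dominates a multiple of the total queue length, so Markov's inequality bounds the inner limsup
by B / (θ C), which vanishes as C grows. -/
theorem stable_of_tight (hB : B ≠ ∞)
    (h : ∀ z ∈ L.space, ∀ᶠ t in atTop,
      ∫⁻ x, W x ∂(PMF.iterate (L.step ε) t z).toMeasure ≤ B)
    {θ : ℝ} (hθ : 0 < θ) (hW : ∀ z, ENNReal.ofReal (θ * ∑ n, (z.1 n : ℝ)) ≤ W z) :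
    L.Stable ε := by
  intro init hinit
  have hlim : Tendsto (fun C : ℝ => B / ENNReal.ofReal (θ * C)) atTop (𝓝 0) := by
    have h1 : Tendsto (fun C : ℝ => ENNReal.ofReal (θ * C)) atTop (𝓝 ∞) :=
      ENNReal.tendsto_ofReal_nhds_top.2 (tendsto_id.const_mul_atTop hθ)
    simpa using ENNReal.Tendsto.const_div (a := B) h1 (Or.inr hB)
  refine le_antisymm ?_ bot_le
  rw [← hlim.limsup_eq]
  refine limsup_le_limsup ?_ (by isBoundedDefault) (by isBoundedDefault)
  filter_upwards [eventually_gt_atTop 0] with C hC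
  refine le_trans (limsup_le_limsup (Eventually.of_forall fun t => ?_) (by isBoundedDefault)
    (by isBoundedDefault)) (PMF.limsup_measure_ge_le h hinit
      (c := ENNReal.ofReal (θ * C)) (by simpa using mul_pos hθ hC) ENNReal.ofReal_ne_top)
  dsimp only
  rw [← pathLaw_state_preimage]
  refine measure_mono fun ω hω => ?_
  exact (ENNReal.ofReal_le_ofReal (mul_le_mul_of_nonneg_left (le_of_lt hω) hθ.le)).trans (hW _)

end LoadBalancing

/-! ### Pathwise estimates for the queue lengths. -/

section Increments

variable {N : ℕ}

theorem EuclideanSpace.norm_le_card_mul {x : EuclideanSpace ℝ (Fin N)} {c : ℝ} (hc : 0 ≤ c)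
    (h : ∀ n, |x n| ≤ c) : ‖x‖ ≤ N * c := by
  rw [EuclideanSpace.norm_eq]
  refine Real.sqrt_le_iff.2 ⟨by positivity, ?_⟩
  calc ∑ n, ‖x n‖ ^ 2 ≤ ∑ _n : Fin N, c ^ 2 :=
        Finset.sum_le_sum fun n _ => pow_le_pow_left₀ (norm_nonneg _) (h n) 2
    _ = N * c ^ 2 := by simp
    _ ≤ (N * c) ^ 2 := by
        rw [mul_pow]
        refine mul_le_mul_of_nonneg_right ?_ (sq_nonneg c)
        exact_mod_cast Nat.le_self_pow two_ne_zero N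

namespace LBSlot

variable {w : LBSlot N} {a s : ℕ}

theorem arrivals_le (ha : w.2.1 ≤ a) (n : Fin N) : w.arrivals n ≤ a := by
  unfold arrivals; split <;> omega

theorem norm_netInput_le (ha : w.2.1 ≤ a) (hs : ∀ n, w.2.2 n ≤ s) :
    ‖w.netInput‖ ≤ N * (a + s) := by
  refine EuclideanSpace.norm_le_card_mul (by positivity) fun n => ?_
  have h1 : (w.arrivals n : ℝ) ≤ a := by exact_mod_cast arrivals_le ha n
  have h2 : (w.services n : ℝ) ≤ s := by exact_mod_cast hs n
  have h3 : (0 : ℝ) ≤ w.arrivals n := by positivity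
  have h4 : (0 : ℝ) ≤ w.services n := by positivity
  change |(w.arrivals n : ℝ) - w.services n| ≤ _
  rw [abs_le]
  constructor <;> linarith

variable {M : Type*} {z z' : LBState N M}

theorem norm_queue_sub_le (hz : z'.1 = nextQueue z.1 w) (ha : w.2.1 ≤ a)
    (hs : ∀ n, w.2.2 n ≤ s) : ‖z'.queue - z.queue‖ ≤ N * (a + s) := by
  refine EuclideanSpace.norm_le_card_mul (by positivity) fun n => ?_
  have h1 := arrivals_le ha n
  have h2 : w.services n ≤ s := hs n
  have hle : z'.1 n ≤ z.1 n + (a + s) := by rw [hz]; unfold nextQueue; omega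
  have hge : z.1 n ≤ z'.1 n + (a + s) := by rw [hz]; unfold nextQueue; omega
  have hle' : (z'.1 n : ℝ) ≤ z.1 n + (a + s) := by exact_mod_cast hle
  have hge' : (z.1 n : ℝ) ≤ z'.1 n + (a + s) := by exact_mod_cast hge
  change |(z'.1 n : ℝ) - z.1 n| ≤ _
  rw [abs_le]
  constructor <;> linarith

/-- Taking the positive part of a coordinate does not increase its square, so the truncation at 0
may be dropped before expanding the norm. -/
theorem norm_queue_sq_le (hz : z'.1 = nextQueue z.1 w) (ha : w.2.1 ≤ a)
    (hs : ∀ n, w.2.2 n ≤ s) :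
    ‖z'.queue‖ ^ 2 ≤ ‖z.queue‖ ^ 2 + 2 * inner ℝ z.queue w.netInput + (N * (a + s)) ^ 2 := by
  have h1 : ‖z'.queue‖ ^ 2 ≤ ‖z.queue + w.netInput‖ ^ 2 := by
    rw [EuclideanSpace.norm_sq_eq, EuclideanSpace.norm_sq_eq]
    refine Finset.sum_le_sum fun n _ => ?_
    rw [Real.norm_eq_abs, Real.norm_eq_abs, sq_abs, sq_abs]
    change (z'.1 n : ℝ) ^ 2 ≤ ((z.1 n : ℝ) + ((w.arrivals n : ℝ) - w.services n)) ^ 2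
    rw [hz]
    unfold nextQueue
    rcases le_total (w.services n) (z.1 n + w.arrivals n) with h | h
    · rw [Nat.cast_sub h]
      push_cast
      exact le_of_eq (by ring)
    · rw [Nat.sub_eq_zero_of_le h]
      simpa using sq_nonneg _
  have h2 : ‖w.netInput‖ ^ 2 ≤ (N * (a + s)) ^ 2 :=
    pow_le_pow_left₀ (norm_nonneg _) (norm_netInput_le ha hs) 2
  rw [norm_add_sq_real] at h1
  linarith

theorem abs_norm_queue_sub_le {z : ℕ → LBState N M} {w : ℕ → LBSlot N}
    (hz : ∀ t, (z (t + 1)).1 = nextQueue (z t).1 (w t)) (ha : ∀ t, (w t).2.1 ≤ a)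
    (hs : ∀ t n, (w t).2.2 n ≤ s) (t₀ n : ℕ) :
    |‖(z (t₀ + n)).queue‖ - ‖(z t₀).queue‖| ≤ n * (N * (a + s)) := by
  induction n with
  | zero => simp
  | succ n ih =>
    have h1 := (abs_norm_sub_norm_le _ _).trans
      (norm_queue_sub_le (hz (t₀ + n)) (ha (t₀ + n)) (hs (t₀ + n)))
    calc _ ≤ _ := abs_sub_le _ ‖(z (t₀ + n)).queue‖ _
      _ ≤ N * (a + s) + n * (N * (a + s)) := add_le_add h1 ih
      _ = _ := by push_cast; ring

theorem norm_queue_sq_le_sum {z : ℕ → LBState N M} {w : ℕ → LBSlot N}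
    (hz : ∀ t, (z (t + 1)).1 = nextQueue (z t).1 (w t)) (ha : ∀ t, (w t).2.1 ≤ a)
    (hs : ∀ t n, (w t).2.2 n ≤ s) (t₀ n : ℕ) :
    ‖(z (t₀ + n)).queue‖ ^ 2 ≤ ‖(z t₀).queue‖ ^ 2
      + 2 * ∑ t ∈ Finset.Ico t₀ (t₀ + n), inner ℝ (z t).queue (w t).netInput
      + n * (N * (a + s)) ^ 2 := by
  induction n with
  | zero => simp
  | succ n ih =>
    rw [← add_assoc, Finset.sum_Ico_succ_top (Nat.le_add_right _ _)]
    have := norm_queue_sq_le (hz (t₀ + n)) (ha (t₀ + n)) (hs (t₀ + n))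
    push_cast
    linarith

/-- Boundedness is needed so that the drift sum is integrable under the conditional law. -/
theorem abs_sum_inner_le {z : ℕ → LBState N M} {w : ℕ → LBSlot N}
    (hz : ∀ t, (z (t + 1)).1 = nextQueue (z t).1 (w t)) (ha : ∀ t, (w t).2.1 ≤ a)
    (hs : ∀ t n, (w t).2.2 n ≤ s) (t₀ n : ℕ) :
    |∑ t ∈ Finset.Ico t₀ (t₀ + n), inner ℝ (z t).queue (w t).netInput|
      ≤ n * ((‖(z t₀).queue‖ + n * (N * (a + s))) * (N * (a + s))) := by
  have hterm : ∀ t ∈ Finset.Ico t₀ (t₀ + n), |inner ℝ (z t).queue (w t).netInput|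
      ≤ (‖(z t₀).queue‖ + n * (N * (a + s))) * (N * (a + s)) := by
    intro t ht
    obtain ⟨k, rfl⟩ := Nat.exists_eq_add_of_le (Finset.mem_Ico.1 ht).1
    have hk : (k : ℝ) ≤ n := by
      have := (Finset.mem_Ico.1 ht).2
      exact_mod_cast (by omega : k ≤ n)
    have h1 := (abs_le.1 (abs_norm_queue_sub_le hz ha hs t₀ k)).2
    have h2 : (k : ℝ) * (N * (a + s)) ≤ n * (N * (a + s)) := by gcongr
    exact (abs_real_inner_le_norm _ _).trans (mul_le_mul (by linarith)
      (norm_netInput_le (ha _) (hs _)) (norm_nonneg _) (by positivity))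
  refine (Finset.abs_sum_le_sum_abs _ _).trans ((Finset.sum_le_card_nsmul _ _ _ hterm).trans ?_)
  simp

end LBSlot

/-- Since (V' - V)² ≥ 0, the increment V' - V is at most (V'² - V²) / (2V), which makes it linear in
Y. The remainder of the exponential is quadratic because |θ (V' - V)| ≤ 1. -/
theorem exp_mul_le_of_sq_le {θ V V' Y e b : ℝ} (hθ : 0 < θ) (hV : 0 < V) (hb : |V' - V| ≤ b)
    (hθb : θ * b ≤ 1) (hsq : V' ^ 2 ≤ V ^ 2 + 2 * Y + e) :
    Real.exp (θ * V') ≤ Real.exp (θ * V) * (1 + θ * ((2 * Y + e) / (2 * V)) + (θ * b) ^ 2) := by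
  have h1 : V' - V ≤ (2 * Y + e) / (2 * V) := by
    rw [le_div_iff₀ (by positivity)]
    nlinarith [sq_nonneg (V' - V)]
  have habs : |θ * (V' - V)| ≤ θ * b := by
    rw [abs_mul, abs_of_pos hθ]
    gcongr
  have h2 := (abs_le.1 (Real.abs_exp_sub_one_sub_id_le (habs.trans hθb))).2
  have h3 : (θ * (V' - V)) ^ 2 ≤ (θ * b) ^ 2 := sq_le_sq' (abs_le.1 habs).1 (abs_le.1 habs).2
  have h4 : θ * (V' - V) ≤ θ * ((2 * Y + e) / (2 * V)) := by gcongr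
  calc Real.exp (θ * V') = Real.exp (θ * V) * Real.exp (θ * (V' - V)) := by
        rw [← Real.exp_add]; congr 1; ring
    _ ≤ _ := by gcongr; linarith

end Increments

/-! ### The exponential Lyapunov function. -/

namespace LoadBalancing

/-- The exponential Lyapunov function. -/
noncomputable def expNorm {N : ℕ} {M : Type*} (θ : ℝ) (z : LBState N M) : ℝ≥0∞ :=
  ENNReal.ofReal (Real.exp (θ * ‖z.queue‖))

section

variable {N : ℕ} {M : Type*} {θ : ℝ}

theorem apply_le_norm_queue (z : LBState N M) (n : Fin N) : (z.1 n : ℝ) ≤ ‖z.queue‖ := by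
  have h := PiLp.norm_apply_le z.queue n
  exact (le_abs_self _).trans h

theorem finite_expNorm_le [Finite M] (hθ : 0 < θ) {c : ℝ≥0∞} (hc : c ≠ ∞) :
    {z : LBState N M | expNorm θ z ≤ c}.Finite := by
  refine ((Set.Finite.pi fun _ : Fin N => Set.finite_Iic ⌊c.toReal / θ⌋₊).prod
    (Set.finite_univ (α := M))).subset fun (z : LBState N M) hz =>
      ⟨fun n _ => ?_, Set.mem_univ _⟩
  refine Nat.le_floor ?_
  rw [le_div_iff₀ hθ]
  have h1 : Real.exp (θ * ‖LBState.queue z‖) ≤ c.toReal := (ENNReal.ofReal_le_iff_le_toReal hc).1 hz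
  have h2 := Real.add_one_le_exp (θ * ‖LBState.queue z‖)
  have h3 := mul_le_mul_of_nonneg_left (apply_le_norm_queue z n) hθ.le
  linarith

theorem ofReal_sum_le_expNorm (hθ : 0 < θ) (z : LBState N M) :
    ENNReal.ofReal (θ / (N + 1) * ∑ n, (z.1 n : ℝ)) ≤ expNorm θ z := by
  refine ENNReal.ofReal_le_ofReal ?_
  have h1 : ∑ n, (z.1 n : ℝ) ≤ (N + 1) * ‖z.queue‖ := by
    calc ∑ n, (z.1 n : ℝ) ≤ ∑ _n : Fin N, ‖z.queue‖ :=
          Finset.sum_le_sum fun n _ => apply_le_norm_queue z n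
      _ = N * ‖z.queue‖ := by simp
      _ ≤ _ := by gcongr; linarith
  calc θ / (N + 1) * ∑ n, (z.1 n : ℝ) ≤ θ / (N + 1) * ((N + 1) * ‖z.queue‖) := by gcongr
    _ = θ * ‖z.queue‖ := by field_simp
    _ ≤ Real.exp (θ * ‖z.queue‖) := by linarith [Real.add_one_le_exp (θ * ‖z.queue‖)]

/-- A single term of the exponential series is at most the whole. -/
theorem ofReal_norm_pow_le (hθ : 0 < θ) (z : LBState N M) (r : ℕ) :
    ENNReal.ofReal (‖z.queue‖ ^ r)
      ≤ ENNReal.ofReal (r.factorial / θ ^ r) * expNorm θ z := by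
  rw [expNorm, ← ENNReal.ofReal_mul (by positivity)]
  refine ENNReal.ofReal_le_ofReal ?_
  have h := Real.pow_div_factorial_le_exp (θ * ‖z.queue‖) (by positivity) r
  rw [div_le_iff₀ (by positivity), mul_pow] at h
  rw [div_mul_eq_mul_div, le_div_iff₀ (by positivity)]
  linarith

theorem moment_le_of_lintegral_expNorm_le [Finite M] [MeasurableSpace M]
    [MeasurableSingletonClass M] (hθ : 0 < θ) {B : ℝ≥0∞} (hB : B ≠ ∞) {p : PMF (LBState N M)}
    (hp : ∫⁻ z, expNorm θ z ∂p.toMeasure ≤ B) (r : ℕ) :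
    Integrable (fun z : LBState N M => ‖z.queue‖ ^ r) p.toMeasure ∧
      ∫ z, ‖z.queue‖ ^ r ∂p.toMeasure ≤ (ENNReal.ofReal (r.factorial / θ ^ r) * B).toReal := by
  have hle : ∫⁻ z : LBState N M, ENNReal.ofReal (‖z.queue‖ ^ r) ∂p.toMeasure
      ≤ ENNReal.ofReal (r.factorial / θ ^ r) * B := by
    refine (lintegral_mono fun z => ofReal_norm_pow_le hθ z r).trans ?_
    rw [lintegral_const_mul _ Measurable.of_discrete]
    gcongr
  have htop : ENNReal.ofReal (r.factorial / θ ^ r) * B ≠ ∞ :=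
    ENNReal.mul_ne_top ENNReal.ofReal_ne_top hB
  have hnn (μ : Measure (LBState N M)) : 0 ≤ᵐ[μ] fun z => ‖z.queue‖ ^ r :=
    ae_of_all _ fun z => by positivity
  have hmeas : AEStronglyMeasurable (fun z : LBState N M => ‖z.queue‖ ^ r) p.toMeasure :=
    (Measurable.of_discrete).aestronglyMeasurable
  refine ⟨⟨hmeas, ?_⟩, ?_⟩
  · rw [hasFiniteIntegral_iff_ofReal (hnn _)]
    exact hle.trans_lt htop.lt_top
  · rw [integral_eq_lintegral_of_nonneg_ae (hnn _) hmeas]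
    exact ENNReal.toReal_mono htop hle

variable (L : LoadBalancing N M) {ε : ℝ}

theorem slot_bounded (hε : ε ∈ Ioc 0 L.muSum) {z : LBState N M} {w : LBSlot N}
    (hw : w ∈ (L.slotLaw ε z).support) : w.2.1 ≤ L.Amax ∧ ∀ n, w.2.2 n ≤ L.Smax := by
  obtain ⟨-, ha, hs⟩ := L.mem_support_slotLaw hw
  exact ⟨L.arrival_le ε hε _ ha, fun n => L.service_le n _ (hs n)⟩

theorem queue_eq_of_mem_support_next {z z' : LBState N M} {w : LBSlot N}
    (h : z' ∈ (L.next z w).support) : z'.1 = LBSlot.nextQueue z.1 w := by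
  simp only [next, PMF.mem_support_map_iff] at h
  obtain ⟨m, -, rfl⟩ := h
  rfl

/-- A bound on the one-step increments of the vector of queue lengths. -/
noncomputable def incrementBound : ℝ := N * (L.Amax + L.Smax)

theorem incrementBound_nonneg : 0 ≤ L.incrementBound := by
  unfold incrementBound; positivity

theorem expNorm_le_of_mem_support_step (hε : ε ∈ Ioc 0 L.muSum) (hθ : 0 < θ)
    {z z' : LBState N M} (h : z' ∈ (L.step ε z).support) :
    expNorm θ z' ≤ ENNReal.ofReal (Real.exp (θ * L.incrementBound)) * expNorm θ z := by
  rw [step, PMF.mem_support_bind_iff] at h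
  obtain ⟨w, hw, hz'⟩ := h
  obtain ⟨ha, hs⟩ := L.slot_bounded hε hw
  rw [expNorm, expNorm, ← ENNReal.ofReal_mul (Real.exp_nonneg _), ← Real.exp_add, ← mul_add]
  refine ENNReal.ofReal_le_ofReal (Real.exp_le_exp.2 (mul_le_mul_of_nonneg_left ?_ hθ.le))
  have h1 := (norm_sub_norm_le _ _).trans
    (LBSlot.norm_queue_sub_le (L.queue_eq_of_mem_support_next hz') ha hs)
  change ‖z'.queue‖ ≤ (N : ℝ) * (L.Amax + L.Smax) + _
  linarith

end

/-! ### Geometric drift of the exponential Lyapunov function. -/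

section Drift

variable {N : ℕ} {M : Type*} [Finite M] [MeasurableSpace M] [MeasurableSingletonClass M]
  (L : LoadBalancing N M) {ε : ℝ}

/-- The path space contains sequences that violate the dynamics. This and the next lemma discard
them, so that the pathwise estimates apply almost surely. -/
theorem ae_slot_mem_support (init : PMF (LBState N M)) :
    ∀ᵐ ω ∂(L.pathLaw ε init), ∀ t, (ω t).2 ∈ (L.slotLaw ε (ω t).1).support := by
  refine ae_all_iff.2 fun t => ?_
  let bad : Set (LBState N M × LBSlot N) := {y | y.2 ∉ (L.slotLaw ε y.1).support}
  have hmeas : MeasurableSet {ω : ℕ → LBState N M × LBSlot N | ω t ∈ bad} :=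
    (measurable_pi_apply t : Measurable fun ω : ℕ → LBState N M × LBSlot N => ω t)
      (MeasurableSet.of_discrete (s := bad))
  have h := L.lintegral_pathLaw_slot ε init t (fun _ => 1) (bad.indicator 1)
  have h0 (z : LBState N M) : ∫⁻ w, bad.indicator (1 : LBState N M × LBSlot N → ℝ≥0∞) (z, w)
      ∂(L.slotLaw ε z).toMeasure = 0 := by
    rw [PMF.lintegral_toMeasure, ENNReal.tsum_eq_zero]
    intro w
    by_cases hw : w ∈ (L.slotLaw ε z).support
    · simp [bad, Set.indicator]
    · simp [(PMF.apply_eq_zero_iff _ _).2 hw]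
  simp only [h0, mul_zero, lintegral_zero, one_mul] at h
  rw [ae_iff, ← h]
  exact (lintegral_indicator_one hmeas).symm

theorem ae_state_mem_support (init : PMF (LBState N M)) :
    ∀ᵐ ω ∂(L.pathLaw ε init), ∀ t, (ω (t + 1)).1 ∈ (L.next (ω t).1 (ω t).2).support := by
  refine ae_all_iff.2 fun t => ?_
  let bad : Set ((LBState N M × LBSlot N) × LBState N M) :=
    {q | q.2 ∉ (L.next q.1.1 q.1.2).support}
  have hmeas : MeasurableSet
      {ω : ℕ → LBState N M × LBSlot N | (ω t, (ω (t + 1)).1) ∈ bad} :=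
    (by fun_prop : Measurable fun ω : ℕ → LBState N M × LBSlot N => (ω t, (ω (t + 1)).1))
      (MeasurableSet.of_discrete (s := bad))
  have h := L.lintegral_pathLaw_succ ε init t
    (f := fun q => bad.indicator 1 (q.1 ⟨t, Finset.mem_Iic.2 le_rfl⟩, q.2.1))
    Measurable.of_discrete
  have h0 (y : LBState N M × LBSlot N) : ∫⁻ y', bad.indicator
      (1 : (LBState N M × LBSlot N) × LBState N M → ℝ≥0∞) (y, y'.1)
      ∂(L.withSlot ε (L.next y.1 y.2)).toMeasure = 0 := by
    rw [lintegral_withSlot]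
    simp only [lintegral_const, measure_univ, mul_one]
    rw [PMF.lintegral_toMeasure, ENNReal.tsum_eq_zero]
    intro z
    by_cases hz : z ∈ (L.next y.1 y.2).support
    · simp [bad, Set.indicator]
    · simp [(PMF.apply_eq_zero_iff _ _).2 hz]
  simp only [Preorder.frestrictLe_apply, h0, lintegral_zero] at h
  rw [ae_iff, ← h]
  exact (lintegral_indicator_one hmeas).symm

/-- The drift condition gives a geometric drift of the exponential Lyapunov function. -/
theorem lintegral_expNorm_le_of_drift (hε : ε ∈ Ioc 0 L.muSum) {T : ℕ} {K₁ γ θ : ℝ}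
    (hK₁ : 0 ≤ K₁) (hγ : 0 < γ) (hθ : 0 < θ) (hθb : θ * (T * L.incrementBound) ≤ 1)
    (hθb' : (θ * (T * L.incrementBound)) ^ 2 ≤ θ * γ / 4) (hθγ : θ * γ ≤ 1)
    (hdrift : L.DriftCondition ε T K₁ γ) {z₀ z : LBState N M} (hz₀ : z₀ ∈ L.space)
    (hz : z ∈ (L.step ε z₀).support) :
    ∫⁻ x, expNorm θ x ∂(PMF.iterate (L.step ε) T z).toMeasure
      ≤ ENNReal.ofReal (1 - θ * γ / 2) * expNorm θ z + ENNReal.ofReal (Real.exp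
        (θ * (1 + (4 * K₁ + 2 * (T * L.incrementBound ^ 2)) / γ + T * L.incrementBound))) := by
  have hD := L.incrementBound_nonneg
  set D := L.incrementBound
  set b := T * D
  set e := T * D ^ 2
  have hb : 0 ≤ b := by positivity
  have he : 0 ≤ e := by positivity
  -- Above this level the error (2 K₁ + e) / (2V) is at most γ / 4; the summand 1 keeps V positive
  -- there.
  set v₀ := 1 + (4 * K₁ + 2 * e) / γ
  set V := ‖z.queue‖
  have hpos : L.pathLaw ε (PMF.pure z₀) {ω | (ω 1).1 = z} ≠ 0 := by
    rwa [pathLaw_state_eq, PMF.pure_bind, PMF.iterate_one]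
  -- Starting at z₀ and taking t₀ = 1 makes z a state of positive probability, as the drift
  -- condition requires.
  have hdz := hdrift (PMF.pure z₀) (by simpa using hz₀) 1 le_rfl z
    (L.step_support_subset hε hz₀ hz) hpos
  set μ := ProbabilityTheory.cond (L.pathLaw ε (PMF.pure z₀)) {ω | (ω 1).1 = z}
  have hμ : IsProbabilityMeasure μ := cond_isProbabilityMeasure hpos
  let X (ω : ℕ → LBState N M × LBSlot N) : ℝ := ‖(ω (1 + T)).1.queue‖
  let Y (ω : ℕ → LBState N M × LBSlot N) : ℝ :=
    ∑ t ∈ Finset.Ico 1 (1 + T), inner ℝ (ω t).1.queue (ω t).2.netInput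
  have hac : μ ≪ L.pathLaw ε (PMF.pure z₀) := cond_absolutelyContinuous
  have hstart : ∀ᵐ ω ∂μ, (ω 1).1 = z :=
    ae_cond_mem ((by fun_prop : Measurable fun ω : ℕ → LBState N M × LBSlot N => (ω 1).1)
      (measurableSet_singleton z))
  have hpath : ∀ᵐ ω ∂μ, |X ω - V| ≤ b ∧ X ω ^ 2 ≤ V ^ 2 + 2 * Y ω + e ∧
      |Y ω| ≤ T * ((V + b) * D) := by
    filter_upwards [hac.ae_le (L.ae_slot_mem_support (PMF.pure z₀)),
      hac.ae_le (L.ae_state_mem_support (PMF.pure z₀)), hstart] with ω hslot hnext h1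
    have hq (t : ℕ) := L.queue_eq_of_mem_support_next (hnext t)
    have ha (t : ℕ) := (L.slot_bounded hε (hslot t)).1
    have hs (t : ℕ) := (L.slot_bounded hε (hslot t)).2
    have e1 := LBSlot.abs_norm_queue_sub_le (z := fun t => (ω t).1) (w := fun t => (ω t).2)
      hq ha hs 1 T
    have e2 := LBSlot.norm_queue_sq_le_sum (z := fun t => (ω t).1) (w := fun t => (ω t).2)
      hq ha hs 1 T
    have e3 := LBSlot.abs_sum_inner_le (z := fun t => (ω t).1) (w := fun t => (ω t).2)
      hq ha hs 1 T
    simp only [h1] at e1 e2 e3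
    exact ⟨e1, e2, e3⟩
  have hXmeas : Measurable fun ω => Real.exp (θ * X ω) :=
    (Measurable.of_discrete (f := fun y : LBState N M × LBSlot N =>
      Real.exp (θ * ‖y.1.queue‖))).comp (measurable_pi_apply (1 + T))
  have hYmeas : Measurable Y := Finset.measurable_fun_sum _ fun t _ =>
    (Measurable.of_discrete (f := fun y : LBState N M × LBSlot N =>
      (inner ℝ y.1.queue y.2.netInput : ℝ))).comp (measurable_pi_apply t)
  have hYint : Integrable Y μ := Integrable.of_bound hYmeas.aestronglyMeasurable _
    (hpath.mono fun ω h => h.2.2)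
  have hXle : ∀ᵐ ω ∂μ, Real.exp (θ * X ω) ≤ Real.exp (θ * (V + b)) := by
    filter_upwards [hpath] with ω h
    refine Real.exp_le_exp.2 (mul_le_mul_of_nonneg_left ?_ hθ.le)
    linarith [(abs_le.1 h.1).2]
  have hXint : Integrable (fun ω => Real.exp (θ * X ω)) μ :=
    Integrable.of_bound hXmeas.aestronglyMeasurable _
      (hXle.mono fun ω h => by rwa [Real.norm_eq_abs, Real.abs_exp])
  have hlint : ∫⁻ x, expNorm θ x ∂(PMF.iterate (L.step ε) T z).toMeasure
      = ENNReal.ofReal (∫ ω, Real.exp (θ * X ω) ∂μ) := by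
    rw [← L.lintegral_cond_pathLaw ε (PMF.pure z₀) hpos T,
      ofReal_integral_eq_lintegral_ofReal hXint (ae_of_all _ fun _ => Real.exp_nonneg _)]
    rfl
  rw [hlint]
  rcases le_or_gt V v₀ with hV | hV
  · refine le_trans (ENNReal.ofReal_le_ofReal ?_) le_add_self
    calc ∫ ω, Real.exp (θ * X ω) ∂μ ≤ ∫ _, Real.exp (θ * (V + b)) ∂μ :=
          integral_mono_ae hXint (integrable_const _) hXle
      _ = Real.exp (θ * (V + b)) := by simp
      _ ≤ _ := by gcongr
  · refine le_trans ?_ le_self_add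
    rw [expNorm, ← ENNReal.ofReal_mul (by linarith)]
    refine ENNReal.ofReal_le_ofReal ?_
    have hVpos : 0 < V := lt_of_le_of_lt (by positivity) hV
    have hle : ∀ᵐ ω ∂μ, Real.exp (θ * X ω) ≤
        Real.exp (θ * V) * (1 + θ * e / (2 * V) + θ * γ / 4) + Real.exp (θ * V) * θ / V * Y ω := by
      filter_upwards [hpath] with ω h
      refine (exp_mul_le_of_sq_le hθ hVpos h.1 hθb h.2.1).trans ?_
      calc _ ≤ Real.exp (θ * V) * (1 + θ * ((2 * Y ω + e) / (2 * V)) + θ * γ / 4) := by gcongr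
        _ = _ := by field_simp; ring
    have hKe : (2 * K₁ + e) / (2 * V) ≤ γ / 4 := by
      rw [div_le_iff₀ (by positivity)]
      have h1 : (4 * K₁ + 2 * e) / γ ≤ V := by linarith
      rw [div_le_iff₀ hγ] at h1
      linarith
    calc ∫ ω, Real.exp (θ * X ω) ∂μ
        ≤ ∫ ω, Real.exp (θ * V) * (1 + θ * e / (2 * V) + θ * γ / 4)
            + Real.exp (θ * V) * θ / V * Y ω ∂μ :=
          integral_mono_ae hXint ((integrable_const _).add (hYint.const_mul _)) hle
      _ = Real.exp (θ * V) * (1 + θ * e / (2 * V) + θ * γ / 4)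
            + Real.exp (θ * V) * θ / V * ∫ ω, Y ω ∂μ := by
          rw [integral_add (integrable_const _) (hYint.const_mul _), integral_const,
            integral_const_mul]
          simp
      _ ≤ Real.exp (θ * V) * (1 + θ * e / (2 * V) + θ * γ / 4)
            + Real.exp (θ * V) * θ / V * (-γ * V + K₁) := by gcongr
      -- The budget: of the decrease θγ, one quarter pays for the quadratic remainder and one
      -- quarter for K₁ and e, which leaves θγ / 2.
      _ = Real.exp (θ * V) * (1 - θ * γ + θ * γ / 4 + θ * ((2 * K₁ + e) / (2 * V))) := by
          field_simp; ring
      _ ≤ Real.exp (θ * V) * (1 - θ * γ + θ * γ / 4 + θ * (γ / 4)) := by gcongr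
      _ = (1 - θ * γ / 2) * Real.exp (θ * V) := by ring

/-- Under the drift condition the expectation of an exponential of the queue lengths is
eventually bounded, by a constant that depends only on the constants of the drift condition. -/
theorem exists_eventually_lintegral_expNorm_le {T : ℕ} {K₁ γ : ℝ} (hT : 0 < T) (hK₁ : 0 ≤ K₁)
    (hγ : 0 < γ) : ∃ θ : ℝ, 0 < θ ∧ ∃ B : ℝ≥0∞, B ≠ ∞ ∧ ∀ ε ∈ Ioc 0 L.muSum,
      L.DriftCondition ε T K₁ γ → ∀ z ∈ L.space, ∀ᶠ t in atTop,
        ∫⁻ x, expNorm θ x ∂(PMF.iterate (L.step ε) t z).toMeasure ≤ B := by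
  have hD := L.incrementBound_nonneg
  set b := T * L.incrementBound
  have hb : 0 ≤ b := by positivity
  -- θ will be 1 / q. The summands b, 4b² / γ and γ of q secure the three smallness conditions on θ.
  set q := 1 + b + 4 * b ^ 2 / γ + γ with hq
  have hq0 : 0 < q := by positivity
  have hbq : b ≤ q := by
    have : 0 ≤ 4 * b ^ 2 / γ := by positivity
    linarith
  have hγq : γ ≤ q := by
    have : 0 ≤ 4 * b ^ 2 / γ := by positivity
    linarith
  have hbq' : 4 * b ^ 2 ≤ γ * q := by
    have : 4 * b ^ 2 / γ ≤ q := by linarith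
    rw [div_le_iff₀ hγ] at this
    linarith
  have hρ : ENNReal.ofReal (1 - q⁻¹ * γ / 2) < 1 := by
    rw [ENNReal.ofReal_lt_one]
    have : 0 < q⁻¹ * γ / 2 := by positivity
    linarith
  refine ⟨q⁻¹, by positivity, _, ?_, fun ε hε hdrift z hz =>
    PMF.eventually_lintegral_iterate_le (fun z hz => L.step_support_subset hε hz) hT hρ
      (ENNReal.one_le_ofReal.2 (Real.one_le_exp (by positivity))) ENNReal.ofReal_ne_top
      (fun z => ENNReal.ofReal_ne_top)
      (fun z₀ hz₀ z hz => L.lintegral_expNorm_le_of_drift hε hK₁ hγ (by positivity) ?_ ?_ ?_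
        hdrift hz₀ hz)
      (fun z _ x hx => L.expNorm_le_of_mem_support_step hε (by positivity) hx) hz⟩
  · have := tsub_pos_of_lt hρ
    finiteness
  · rw [inv_mul_le_iff₀ hq0]; linarith
  · rw [mul_pow, inv_pow]
    field_simp
    linarith
  · rw [inv_mul_le_iff₀ hq0]; linarith

end Drift

end LoadBalancing

/-! ### The main theorem. -/

theorem lemma1 {N : ℕ} {M : Type*} [Finite M] [MeasurableSpace M] [MeasurableSingletonClass M]
    (L : LoadBalancing N M) :
    ((∀ ε ∈ Set.Ioc 0 L.muSum, ∃ (T₁ : ℕ) (K₁ γ : ℝ), 0 < T₁ ∧ 0 ≤ K₁ ∧ 0 < γ ∧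
        L.DriftCondition ε T₁ K₁ γ) →
      L.ThroughputOptimal) ∧
    (∀ E ⊆ Set.Ioc 0 L.muSum, ∀ (T₁ : ℕ) (K₁ γ : ℝ), 0 < T₁ → 0 ≤ K₁ → 0 < γ →
      (∀ ε ∈ E, L.DriftCondition ε T₁ K₁ γ) →
        (∀ ε ∈ E, L.PositiveRecurrent ε ∧ L.Stable ε ∧ ∃ p, L.IsStationary ε p) ∧
        ∃ Mr : ℕ → ℝ, ∀ ε ∈ E, ∀ p, L.IsStationary ε p → ∀ r : ℕ,
          MeasureTheory.Integrable (fun z : LBState N M => ‖z.queue‖ ^ r) p.toMeasure ∧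
            ∫ z, ‖z.queue‖ ^ r ∂p.toMeasure ≤ Mr r) := by
  have hstable {θ : ℝ} (hθ : 0 < θ) : 0 < θ / (N + 1) := by positivity
  refine ⟨fun h ε hε => ?_, fun E hE T₁ K₁ γ hT₁ hK₁ hγ hdrift => ?_⟩
  · obtain ⟨T₁, K₁, γ, hT₁, hK₁, hγ, hdrift⟩ := h ε hε
    obtain ⟨θ, hθ, B, hB, htight⟩ := L.exists_eventually_lintegral_expNorm_le hT₁ hK₁ hγ
    exact LoadBalancing.stable_of_tight hB (htight ε hε hdrift) (hstable hθ)
      (LoadBalancing.ofReal_sum_le_expNorm hθ)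
  · obtain ⟨θ, hθ, B, hB, htight⟩ := L.exists_eventually_lintegral_expNorm_le hT₁ hK₁ hγ
    have hfin (c : ℝ≥0∞) (hc : c ≠ ∞) := LoadBalancing.finite_expNorm_le (N := N) (M := M) hθ hc
    refine ⟨fun ε hε => ?_, fun r => (ENNReal.ofReal (r.factorial / θ ^ r) * B).toReal,
      fun ε hε p hp r => ?_⟩
    · have h := htight ε (hE hε) (hdrift ε hε)
      exact ⟨LoadBalancing.positiveRecurrent_of_tight (hE hε) hfin hB h,
        LoadBalancing.stable_of_tight hB h (hstable hθ)
          (LoadBalancing.ofReal_sum_le_expNorm hθ),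
        LoadBalancing.exists_isStationary_of_tight (hE hε) hfin hB h⟩
    · exact LoadBalancing.moment_le_of_lintegral_expNorm_le hθ hB
        (PMF.lintegral_le_of_stationary hp.2 hp.1 (htight ε (hE hε) (hdrift ε hε))) r
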